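/- Let $(X_i,T_i)_{i\ge1}$ be independent pairs of random variables with $X_i$ independent of $T_i$. The $X_i$ take values in $[0,1]$ and have common distribution function $F$ and density $f$; the $T_i$ have common density $q$, which is strictly positive on $[0,1]$ and zero elsewhere. Put $\Delta_i=1_{[X_i\le T_i]}$, and $V_i=T_i$ if $\Delta_i=1$, $V_i=T_i+1$ if $\Delta_i=0$; the $V_i$ have density $g(v)=(q(v)+q(v-1))(F(v)-F(v-1))$. Let $w$ be a continuously differentiable symmetric probability density with support in $[-1,1]$ (Condition W). For bandwidths $h,\tilde h$ put $$g_{nh}(y)=\frac1{nh}\sum_{i=1}^n w\Big(\frac{y-V_i}{h}\Big),\qquad q_{n\tilde h}(y)=\frac1{n\tilde h}\sum_{i=1}^n w\Big(\frac{y-T_i}{\tilde h}\Big),$$ with derivatives $g_{nh}'$, $q_{n\tilde h}'$ in $y$. Let $0<x<1$, let $\hat F_n(x)$ be an estimator of $F(x)$, and set $$f_{nh\tilde h}(x)=(1-\hat F_n(x))\Big(\frac{g_{nh}'(x)}{q_{n\tilde h}(x)}-\frac{q_{n\tilde h}'(x)}{q_{n\tilde h}(x)^2}g_{nh}(x)\Big)-\hat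 F_n(x)\Big(\frac{g_{nh}'(x+1)}{q_{n\tilde h}(x)}-\frac{q_{n\tilde h}'(x)}{q_{n\tilde h}(x)^2}g_{nh}(x+1)\Big).$$ Further let $$b^-(x)=\frac{g'''(x)}{q(x)}-\frac{q'(x)}{q(x)^2}g''(x),\qquad b^+(x)=-\frac{g'''(x+1)}{q(x)}+\frac{q'(x)}{q(x)^2}g''(x+1),$$ $$\sigma^2=F(x)(1-F(x))\frac1{q(x)}\int w'(u)^2\,du.$$ Theorem. Assume that $f$ is twice and $q$ is three times continuously differentiable on a neighbourhood of $x$, and that $E(\hat F_n(x)-F(x))^2\to0$ as $n\to\infty$. (i) If $h=cn^{-1/7}$ and $\tilde h=\tilde cn^{-1/7}$ with constants $c,\tilde c>0$, then, as $n\to\infty$, $$n^{2/7}\big(f_{nh\tilde h}(x)-f(x)\big)\xrightarrow{\mathcal D}N(\mu,c^{-3}\sigma^2),$$ $$\mu=\frac12\int_{-\infty}^{\infty}v^2w(v)\,dv\,\Big(c^2\big((1-F(x))b^-(x)+F(x)b^+(x)\big)-\tilde c^2\,\frac{f(x)q''(x)}{q(x)}\Big).$$ (ii) If $h=h_n$ satisfies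 $nh^3\to\infty$ and $h=o(n^{-1/7})$, and $\tilde h=\tilde cn^{-1/7}$ with a constant $\tilde c>0$, then, as $n\to\infty$, $$\sqrt{nh^3}\,\big(f_{nh\tilde h}(x)-f(x)\big)\xrightarrow{\mathcal D}N(0,\sigma^2).$$ (If $\sigma^2=0$, the limit is the point mass at the mean.) -/

import Mathlib

open MeasureTheory ProbabilityTheory Filter Topology Asymptotics

/-- Condition W: `w` is a continuously differentiable symmetric probability density on the real
line, supported in `[-1, 1]`. -/
structure ConditionW (w : ℝ → ℝ) : Prop where
  contDiff : ContDiff ℝ 1 w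
  symm : ∀ u, w (-u) = w u
  nonneg : ∀ u, 0 ≤ w u
  integral_eq_one : ∫ u, w u = 1
  support_subset : Function.support w ⊆ Set.Icc (-1) 1

/-- The transformed current status observation: `V = T` if `Δ = 1`, that is `X ≤ T`, and
`V = T + 1` if `Δ = 0`. -/
noncomputable def transformedObs (X T : ℝ) : ℝ := if X ≤ T then T else T + 1

/-- The kernel density estimator `(1 / (n h)) ∑ w ((y - Y_i) / h)` at the point `y`, computed from
the first `n` terms of the sample `Y`. -/
noncomputable def kernelEst (w : ℝ → ℝ) (n : ℕ) (h : ℝ) (Y : ℕ → ℝ) (y : ℝ) : ℝ :=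
  (1 / (n : ℝ)) * ∑ i ∈ Finset.range n, (1 / h) * w ((y - Y i) / h)

/-- The derivative `(1 / (n h²)) ∑ w' ((y - Y_i) / h)` of the kernel density estimator. -/
noncomputable def kernelDerivEst (w : ℝ → ℝ) (n : ℕ) (h : ℝ) (Y : ℕ → ℝ) (y : ℝ) : ℝ :=
  (1 / (n : ℝ)) * ∑ i ∈ Finset.range n, (1 / h ^ 2) * deriv w ((y - Y i) / h)

/-- `kernelDerivEst` is indeed the derivative of `kernelEst`. -/
theorem hasDerivAt_kernelEst {w : ℝ → ℝ} (hw : ConditionW w) (n : ℕ) (h : ℝ) (Y : ℕ → ℝ)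
    (y : ℝ) : HasDerivAt (kernelEst w n h Y) (kernelDerivEst w n h Y y) y := by
  unfold kernelEst kernelDerivEst
  refine HasDerivAt.const_mul _ (HasDerivAt.fun_sum fun i _ => ?_)
  have hd : HasDerivAt w (deriv w ((y - Y i) / h)) ((y - Y i) / h) :=
    (hw.contDiff.differentiable (by norm_num) _).hasDerivAt
  have h1 : HasDerivAt (fun y : ℝ => (y - Y i) / h) (1 / h) y :=
    ((hasDerivAt_id y).sub_const (Y i)).div_const h
  have h2 : 1 / h ^ 2 * deriv w ((y - Y i) / h) = 1 / h * (deriv w ((y - Y i) / h) * (1 / h)) := by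
    ring
  rw [h2]
  exact (hd.comp y h1).const_mul (1 / h)

/-- The left estimator `f⁻`, as a function of the values `q₀`, `q₁` of (an estimate of) the density
of the observation times and of its derivative at `y`, and of the transformed sample `V`. -/
noncomputable def leftEst (w : ℝ → ℝ) (n : ℕ) (h : ℝ) (V : ℕ → ℝ) (q₀ q₁ y : ℝ) : ℝ :=
  1 / q₀ * kernelDerivEst w n h V y - q₁ / q₀ ^ 2 * kernelEst w n h V y

/-- The right estimator `f⁺`. -/
noncomputable def rightEst (w : ℝ → ℝ) (n : ℕ) (h : ℝ) (V : ℕ → ℝ) (q₀ q₁ y : ℝ) : ℝ :=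
  -(1 / q₀ * kernelDerivEst w n h V (y + 1) - q₁ / q₀ ^ 2 * kernelEst w n h V (y + 1))

/-- The final estimator of the density of the `X i` at `y` when `q` is unknown:
`(1 - φ) f⁻ + φ f⁺`, with `q` and `q'` replaced by the kernel estimator with bandwidth `h'` based
on `T 0, …, T (n - 1)` and its derivative. Here `φ` is the value of the estimator of the
distribution function of the `X i` at `y`. -/
noncomputable def finalEst (w : ℝ → ℝ) (n : ℕ) (h h' : ℝ) (X T : ℕ → ℝ) (φ y : ℝ) : ℝ :=
  (1 - φ) * leftEst w n h (fun i => transformedObs (X i) (T i))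
      (kernelEst w n h' T y) (kernelDerivEst w n h' T y) y
    + φ * rightEst w n h (fun i => transformedObs (X i) (T i))
      (kernelEst w n h' T y) (kernelDerivEst w n h' T y) y

/-- The density `g(v) = (q(v) + q(v-1)) (F(v) - F(v-1))` of the transformed observations, where
`F` is the distribution function of the `X i` and `q` is the density of the `T i`. -/
noncomputable def obsDensity (F q : ℝ → ℝ) (v : ℝ) : ℝ :=
  (q v + q (v - 1)) * (F v - F (v - 1))

/-- The bias factor `b⁻` of the left estimator. -/
noncomputable def biasLeft (F q : ℝ → ℝ) (y : ℝ) : ℝ :=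
  1 / q y * iteratedDeriv 3 (obsDensity F q) y
    - deriv q y / q y ^ 2 * iteratedDeriv 2 (obsDensity F q) y

/-- The bias factor `b⁺` of the right estimator. -/
noncomputable def biasRight (F q : ℝ → ℝ) (y : ℝ) : ℝ :=
  -(1 / q y) * iteratedDeriv 3 (obsDensity F q) (y + 1)
    + deriv q y / q y ^ 2 * iteratedDeriv 2 (obsDensity F q) (y + 1)

/-- The mean `μ` of the limit distribution, for bandwidths `c n^(-1/7)` and `c' n^(-1/7)`. -/
noncomputable def limitMean (w f q F : ℝ → ℝ) (c c' y : ℝ) : ℝ :=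
  1 / 2 * (∫ v, v ^ 2 * w v) *
    (c ^ 2 * ((1 - F y) * biasLeft F q y + F y * biasRight F q y)
      - c' ^ 2 * (f y * iteratedDeriv 2 q y / q y))

/-- The variance `σ²` of the limit distribution. -/
noncomputable def limitVar (w q F : ℝ → ℝ) (y : ℝ) : ℝ :=
  F y * (1 - F y) * (1 / q y) * ∫ u, deriv w u ^ 2

/-! Let Δ be the indicator of X ≤ T. As T lies in [0, 1], for small h the kernel at x sees only
observations with Δ = 1 and the kernel at x + 1 only those with Δ = 0, so everything becomes a
kernel average over the T_i at the single point x. At bandwidth h let A and B be the averages with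
kernels w' and w and weights Δ - F(x), and S and R those with weight 1; let Q' and Q be the averages
with weight 1 at the other bandwidth. Then (`finalEst_eq`) the estimator equals A/Q - (Q'/Q²) B +
(F̂ - F(x)) (Q' R/Q² - S/Q).

A and B smooth p = (F - F(x)) q, for which p(x) = 0 and p'(x) = q(x) f(x); hence A/Q estimates f(x).
Let r be the normalization, with r²/(n h³) convergent. Then r (A - q f) is asymptotically normal
(`tendstoInDistribution_kernelAvg`). Averages with w instead of w' have a variance smaller by the
order of the squared bandwidth, so r (Q - q), r (R - q) and r B converge in probability to
deterministic biases (`tendsto_probFilter_kernelAvg`); r (Q' - q') and r (S - q') stay bounded in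
mean square. By `linearization_identity` the error is r (A - q f)/q - f r (Q - q)/q - (q'/q²) r B +
o_P(1). The term with F̂ drops out without any rate for F̂: both parts of Q' R/Q² - S/Q estimate
q'/q, so after multiplication by r the difference is still bounded in probability, and F̂ - F(x)
tends to zero.

The biases are of second order because w is even; they involve p'' and p''', which
`iteratedDeriv_weightedDensity_eq` turns into derivatives of g at x and x + 1. Both claims are
instances of `tendstoInDistribution_finalEst`; in (ii) the factors r h² and r h̃² tend to zero. -/

/-! ### Convergence in probability as a filter, so that limit calculus applies to it. -/

/-- The filter on `ℕ × Ω` along which convergence means convergence in probability: a set belongs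
to it if the probability of its sections tends to one. -/
def probFilter {Ω : Type*} [MeasurableSpace Ω] (P : Measure Ω) : Filter (ℕ × Ω) where
  sets := {S | Tendsto (fun n : ℕ => P {ω | (n, ω) ∉ S}) atTop (𝓝 0)}
  univ_sets := by simp
  sets_of_superset {S S'} hS hSS' :=
    tendsto_of_tendsto_of_tendsto_of_le_of_le tendsto_const_nhds hS (fun _ => zero_le)
      fun n => measure_mono fun ω hω h => hω (hSS' h)
  inter_sets {S S'} hS hS' := by
    have h : Tendsto (fun n : ℕ => P {ω | (n, ω) ∉ S} + P {ω | (n, ω) ∉ S'}) atTop (𝓝 0) := by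
      simpa using Tendsto.add hS hS'
    refine tendsto_of_tendsto_of_tendsto_of_le_of_le tendsto_const_nhds h (fun _ => zero_le)
      fun n => (measure_mono fun ω hω => ?_).trans (measure_union_le _ _)
    by_contra hc
    simp only [Set.mem_union, Set.mem_ofPred_eq, not_or, not_not] at hc
    exact hω hc

section ProbFilter

variable {Ω : Type*} [MeasurableSpace Ω] {P : Measure Ω}

theorem eventually_probFilter_iff {p : ℕ × Ω → Prop} :
    (∀ᶠ z in probFilter P, p z) ↔ Tendsto (fun n : ℕ => P {ω | ¬ p (n, ω)}) atTop (𝓝 0) :=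
  Iff.rfl

theorem eventually_probFilter_of_ae {p : ℕ × Ω → Prop}
    (h : ∀ᶠ n : ℕ in atTop, ∀ᵐ ω ∂P, p (n, ω)) : ∀ᶠ z in probFilter P, p z := by
  rw [eventually_probFilter_iff]
  exact tendsto_const_nhds.congr' (h.mono fun n hn => (ae_iff.1 hn).symm)

theorem tendsto_fst_probFilter : Tendsto Prod.fst (probFilter P) atTop := fun s hs =>
  eventually_probFilter_of_ae
    ((show ∀ᶠ n in atTop, n ∈ s from hs).mono fun _ hn => Eventually.of_forall fun _ => hn)

/-- Convergence in probability along `probFilter` is convergence in measure. -/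
theorem tendstoInMeasure_of_tendsto_probFilter {Y : ℕ → Ω → ℝ}
    (h : Tendsto (fun z : ℕ × Ω => Y z.1 z.2) (probFilter P) (𝓝 0)) :
    TendstoInMeasure P Y atTop 0 := by
  rw [tendstoInMeasure_iff_norm]
  intro ε hε
  have h1 : ∀ᶠ z : ℕ × Ω in probFilter P, ‖Y z.1 z.2‖ < ε := by
    have := h.norm
    rw [norm_zero] at this
    exact this.eventually_lt_const hε
  rw [eventually_probFilter_iff] at h1
  simpa using h1

theorem measure_abs_ge_le_lintegral_sq {Y : Ω → ℝ} (hY : Measurable Y) {ε : ℝ} (hε : 0 < ε) :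
    P {ω | ε ≤ |Y ω|} ≤ (∫⁻ ω, ENNReal.ofReal (Y ω ^ 2) ∂P) / ENNReal.ofReal (ε ^ 2) := by
  refine (measure_mono fun ω hω => ?_).trans (meas_ge_le_lintegral_div
    (hY.pow_const 2).ennreal_ofReal.aemeasurable (by positivity) ENNReal.ofReal_ne_top)
  have : ε ≤ |Y ω| := hω
  refine ENNReal.ofReal_le_ofReal ?_
  rw [← sq_abs (Y ω)]
  gcongr

/-- Mean square convergence to zero implies convergence in probability. -/
theorem tendsto_probFilter_of_lintegral_sq {Y : ℕ → Ω → ℝ} (hY : ∀ n, Measurable (Y n))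
    (h : Tendsto (fun n => ∫⁻ ω, ENNReal.ofReal (Y n ω ^ 2) ∂P) atTop (𝓝 0)) :
    Tendsto (fun z : ℕ × Ω => Y z.1 z.2) (probFilter P) (𝓝 0) := by
  rw [Metric.tendsto_nhds]
  intro ε hε
  rw [eventually_probFilter_iff]
  have h2 := ENNReal.Tendsto.div_const h (b := ENNReal.ofReal (ε ^ 2))
    (Or.inr (by simpa using by positivity))
  rw [ENNReal.zero_div] at h2
  refine tendsto_of_tendsto_of_tendsto_of_le_of_le tendsto_const_nhds h2 (fun _ => zero_le)
    fun n => ?_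
  simpa using measure_abs_ge_le_lintegral_sq (hY n) hε

/-- A sequence bounded in mean square times one that tends to zero in probability tends to zero
in probability. -/
theorem tendsto_mul_probFilter_of_lintegral_sq_le {Y W : ℕ → Ω → ℝ} (hY : ∀ n, Measurable (Y n))
    {C : ℝ} (h : ∀ᶠ n in atTop, ∫⁻ ω, ENNReal.ofReal (Y n ω ^ 2) ∂P ≤ ENNReal.ofReal C)
    (hW : Tendsto (fun z : ℕ × Ω => W z.1 z.2) (probFilter P) (𝓝 0)) :
    Tendsto (fun z : ℕ × Ω => Y z.1 z.2 * W z.1 z.2) (probFilter P) (𝓝 0) := by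
  rw [Metric.tendsto_nhds]
  intro ε hε
  rw [eventually_probFilter_iff, ENNReal.tendsto_nhds_zero]
  intro δ hδ
  have hM : Tendsto (fun M : ℝ => ENNReal.ofReal (C / M ^ 2)) atTop (𝓝 0) := by
    rw [← ENNReal.ofReal_zero]
    exact ENNReal.tendsto_ofReal (tendsto_const_nhds.div_atTop (tendsto_pow_atTop two_ne_zero))
  have hδ2 : 0 < δ / 2 := ENNReal.half_pos hδ.ne'
  obtain ⟨M, hMδ, hM0⟩ :=
    ((ENNReal.tendsto_nhds_zero.1 hM _ hδ2).and (eventually_gt_atTop 0)).exists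
  have hW' := (Metric.tendsto_nhds.1 hW) (ε / M) (by positivity)
  rw [eventually_probFilter_iff, ENNReal.tendsto_nhds_zero] at hW'
  filter_upwards [h, hW' _ hδ2] with n hn hWn
  -- M makes the Chebyshev bound C / M² at most δ / 2; a product of size at least ε forces |Y| ≥ M
  -- or |W| ≥ ε / M.
  have hsub : {ω | ¬ dist (Y n ω * W n ω) 0 < ε} ⊆
      {ω | M ≤ |Y n ω|} ∪ {ω | ¬ dist (W n ω) 0 < ε / M} := by
    intro ω hω
    by_contra hc
    simp only [Set.mem_union, Set.mem_ofPred_eq, not_or, not_le, dist_zero_right,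
      Real.norm_eq_abs, norm_mul, not_lt] at hω hc
    have h3 : |Y n ω| * |W n ω| < M * (ε / M) :=
      mul_lt_mul'' hc.1 hc.2 (abs_nonneg _) (abs_nonneg _)
    rw [mul_div_cancel₀ _ hM0.ne'] at h3
    linarith
  calc P {ω | ¬ dist (Y n ω * W n ω) 0 < ε}
      ≤ P {ω | M ≤ |Y n ω|} + P {ω | ¬ dist (W n ω) 0 < ε / M} :=
        (measure_mono hsub).trans (measure_union_le _ _)
    _ ≤ δ / 2 + δ / 2 := by
        refine add_le_add (((measure_abs_ge_le_lintegral_sq (hY n) hM0).trans ?_).trans hMδ) hWn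
        rw [ENNReal.ofReal_div_of_pos (by positivity)]
        gcongr
    _ = δ := ENNReal.add_halves δ

end ProbFilter

/-! ### Central limit theorem for triangular arrays, by characteristic functions. -/

section TriangularArray

theorem norm_cexp_mul_I_sub_le {y : ℝ} (hy : |y| ≤ 1) :
    ‖Complex.exp (y * Complex.I) - (1 + y * Complex.I - y ^ 2 / 2)‖ ≤ |y| ^ 3 := by
  have hn : ‖(y * Complex.I : ℂ)‖ = |y| := by simp
  have h := Complex.exp_bound (x := y * Complex.I) (by rw [hn]; exact hy) (n := 3) (by norm_num)
  have hs : ∑ m ∈ Finset.range 3, (y * Complex.I : ℂ) ^ m / (m.factorial : ℂ)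
      = 1 + y * Complex.I - y ^ 2 / 2 := by
    simp [Finset.sum_range_succ, mul_pow, Nat.factorial]
    ring
  rw [hs, hn] at h
  -- The constant in the exponential bound of order three is 4 / (3! · 3), which is below 1.
  refine h.trans (mul_le_of_le_one_right (by positivity) ?_)
  norm_num [Nat.factorial]

/-- The characteristic function of a bounded random variable, to second order. -/
theorem norm_integral_cexp_sub_le {E : Type*} [MeasurableSpace E] (ν : Measure E)
    [IsProbabilityMeasure ν] {ψ : E → ℝ} (hψ : Measurable ψ) {b t : ℝ} (hb : ∀ z, |ψ z| ≤ b)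
    (hbt : |t| * b ≤ 1) :
    ‖(∫ z, Complex.exp (t * ψ z * Complex.I) ∂ν)
        - (1 + t * (∫ z, ψ z ∂ν : ℝ) * Complex.I - t ^ 2 * (∫ z, ψ z ^ 2 ∂ν : ℝ) / 2)‖
      ≤ |t| ^ 3 * b * ∫ z, ψ z ^ 2 ∂ν := by
  have hψb : ∀ z, |ψ z ^ 2| ≤ b ^ 2 := fun z => by
    rw [abs_of_nonneg (sq_nonneg _), ← sq_abs (ψ z)]
    gcongr
    exact hb z
  have i1 : Integrable ψ ν := .of_bound hψ.aestronglyMeasurable b (.of_forall hb)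
  have i2 : Integrable (fun z => ψ z ^ 2) ν :=
    .of_bound (hψ.pow_const 2).aestronglyMeasurable (b ^ 2) (.of_forall hψb)
  have ie : Integrable (fun z => Complex.exp (t * ψ z * Complex.I)) ν := by
    refine .of_bound (by fun_prop) 1 (.of_forall fun z => ?_)
    have : (t * ψ z * Complex.I : ℂ) = ((t * ψ z : ℝ) : ℂ) * Complex.I := by push_cast; ring
    rw [this, Complex.norm_exp_ofReal_mul_I]
  have j1 : Integrable (fun z => ((t : ℂ) * (ψ z : ℂ)) * Complex.I) ν :=
    (i1.ofReal.const_mul _).mul_const _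
  have j2 : Integrable (fun z => (t : ℂ) ^ 2 * ((ψ z ^ 2 : ℝ) : ℂ) / 2) ν :=
    (i2.ofReal.const_mul _).div_const _
  have j3 : Integrable (fun z => (1 : ℂ) + t * ψ z * Complex.I) ν :=
    (integrable_const _).add j1
  have e : (1 + t * (∫ z, ψ z ∂ν : ℝ) * Complex.I - t ^ 2 * (∫ z, ψ z ^ 2 ∂ν : ℝ) / 2 : ℂ)
      = ∫ z, ((1 : ℂ) + t * ψ z * Complex.I - t ^ 2 * ((ψ z ^ 2 : ℝ) : ℂ) / 2) ∂ν := by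
    rw [integral_sub j3 j2, integral_add (integrable_const _) j1, integral_mul_const,
      integral_const_mul, integral_div, integral_const_mul, integral_complex_ofReal, integral_complex_ofReal]
    simp
  have j4 : Integrable (fun z => (1 : ℂ) + t * ψ z * Complex.I
      - (t : ℂ) ^ 2 * ((ψ z ^ 2 : ℝ) : ℂ) / 2) ν := j3.sub j2
  rw [e, ← integral_sub ie j4, ← integral_const_mul]
  refine norm_integral_le_of_norm_le (i2.const_mul _) (.of_forall fun z => ?_)
  have hz : |t * ψ z| ≤ |t| * b := by rw [abs_mul]; gcongr; exact hb z
  have h := norm_cexp_mul_I_sub_le (hz.trans hbt)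
  -- Only one factor of the cube is bounded by b; the second moment is kept, since n times it
  -- converges.
  have h3 : |t * ψ z| ^ 3 ≤ |t| ^ 3 * b * ψ z ^ 2 := by
    rw [abs_mul, ← sq_abs (ψ z)]
    have := hb z
    calc (|t| * |ψ z|) ^ 3 = |t| ^ 3 * |ψ z| * |ψ z| ^ 2 := by ring
      _ ≤ |t| ^ 3 * b * |ψ z| ^ 2 := by gcongr
  refine le_trans (le_of_eq ?_) (h.trans h3)
  push_cast
  congr 1
  ring

variable {Ω : Type*} [MeasurableSpace Ω] {P : Measure Ω} [IsProbabilityMeasure P]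

/-- **Central limit theorem** for the row sums of a triangular array of uniformly negligible
functions of an i.i.d. sequence. -/
theorem tendstoInDistribution_sum_of_bounded {E : Type*} [MeasurableSpace E] {Z : ℕ → Ω → E}
    (hZ : ∀ i, Measurable (Z i)) (hind : iIndepFun Z P) {ν : Measure E} [IsProbabilityMeasure ν]
    (hlaw : ∀ i, P.map (Z i) = ν) {ψ : ℕ → E → ℝ} (hψ : ∀ n, Measurable (ψ n)) {b : ℕ → ℝ}
    (hb : Tendsto b atTop (𝓝 0)) (hψb : ∀ᶠ n in atTop, ∀ z, |ψ n z| ≤ b n) {μ v : ℝ}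
    (hμ : Tendsto (fun n : ℕ => n * ∫ z, ψ n z ∂ν) atTop (𝓝 μ))
    (hv : Tendsto (fun n : ℕ => n * ∫ z, ψ n z ^ 2 ∂ν) atTop (𝓝 v)) :
    TendstoInDistribution (fun n ω => ∑ i ∈ Finset.range n, ψ n (Z i ω)) atTop (id : ℝ → ℝ)
      (fun _ => P) (gaussianReal μ v.toNNReal) where
  forall_aemeasurable n :=
    (Finset.measurable_fun_sum _ fun i _ => (hψ n).comp (hZ i)).aemeasurable
  tendsto := by
    have hv0 : 0 ≤ v := ge_of_tendsto' hv fun n =>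
      mul_nonneg (Nat.cast_nonneg _) (integral_nonneg fun _ => sq_nonneg _)
    refine ProbabilityMeasure.tendsto_iff_tendsto_charFun.2 fun t => ?_
    rw! [Measure.map_id]
    have hchar : ∀ n : ℕ, charFun (P.map fun ω => ∑ i ∈ Finset.range n, ψ n (Z i ω)) t
        = (1 + ((∫ z, Complex.exp (t * ψ n z * Complex.I) ∂ν) - 1)) ^ n := by
      intro n
      have hind' := (hind.comp (fun _ => ψ n) fun _ => hψ n)
      rw [iIndepFun.charFun_map_fun_finsetSum_eq_prod
        (X := fun i ω => ψ n (Z i ω)) (fun i _ => ((hψ n).comp (hZ i)).aemeasurable)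
        (hind'.restrict _), Finset.prod_apply, Finset.prod_congr rfl (g := fun _ =>
          ∫ z, Complex.exp (t * ψ n z * Complex.I) ∂ν), Finset.prod_const, Finset.card_range]
      · ring
      · intro i _
        rw [charFun_apply_real, ← hlaw i]
        rw [integral_map (φ := fun ω => ψ n (Z i ω)) ((hψ n).comp (hZ i)).aemeasurable
            (by fun_prop),
          integral_map (hZ i).aemeasurable (by fun_prop)]
    -- The characteristic function of the row sum is (1 + zₙ)ⁿ, so the limit of n zₙ is the exponent
    -- of the limit law.
    have key : Tendsto (fun n : ℕ => (n : ℂ) *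
        ((∫ z, Complex.exp (t * ψ n z * Complex.I) ∂ν) - 1)) atTop
        (𝓝 (t * μ * Complex.I - v * t ^ 2 / 2)) := by
      have hmain : Tendsto (fun n : ℕ => (t * ((n * ∫ z, ψ n z ∂ν : ℝ) : ℂ) * Complex.I
          - ((n * ∫ z, ψ n z ^ 2 ∂ν : ℝ) : ℂ) * t ^ 2 / 2 : ℂ)) atTop
          (𝓝 (t * μ * Complex.I - v * t ^ 2 / 2)) := by
        have h1 := (Complex.continuous_ofReal.tendsto _).comp hμ
        have h2 := (Complex.continuous_ofReal.tendsto _).comp hv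
        exact ((h1.const_mul _).mul_const _).sub ((h2.mul_const _).div_const _)
      have hbt : ∀ᶠ n in atTop, |t| * b n ≤ 1 := by
        have := hb.const_mul |t|
        rw [mul_zero] at this
        exact (this.eventually_lt_const one_pos).mono fun _ h => h.le
      have hrem : Tendsto (fun n : ℕ => |t| ^ 3 * b n * (n * ∫ z, ψ n z ^ 2 ∂ν)) atTop (𝓝 0) := by
        simpa using (hb.const_mul (|t| ^ 3)).mul hv
      have hdiff : Tendsto (fun n : ℕ => (n : ℂ) *
          ((∫ z, Complex.exp (t * ψ n z * Complex.I) ∂ν) - 1)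
          - (t * ((n * ∫ z, ψ n z ∂ν : ℝ) : ℂ) * Complex.I
            - ((n * ∫ z, ψ n z ^ 2 ∂ν : ℝ) : ℂ) * t ^ 2 / 2 : ℂ)) atTop (𝓝 0) := by
        refine squeeze_zero_norm' ?_ hrem
        filter_upwards [hψb, hbt] with n hn hbn
        have h := norm_integral_cexp_sub_le ν (hψ n) hn hbn
        have e : (n : ℂ) * ((∫ z, Complex.exp (t * ψ n z * Complex.I) ∂ν) - 1)
            - (t * ((n * ∫ z, ψ n z ∂ν : ℝ) : ℂ) * Complex.I
              - ((n * ∫ z, ψ n z ^ 2 ∂ν : ℝ) : ℂ) * t ^ 2 / 2 : ℂ)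
            = n * ((∫ z, Complex.exp (t * ψ n z * Complex.I) ∂ν)
              - (1 + t * (∫ z, ψ n z ∂ν : ℝ) * Complex.I
                - t ^ 2 * (∫ z, ψ n z ^ 2 ∂ν : ℝ) / 2)) := by
          push_cast
          ring
        rw [e, norm_mul, Complex.norm_natCast]
        calc (n : ℝ) * _ ≤ n * (|t| ^ 3 * b n * ∫ z, ψ n z ^ 2 ∂ν) := by gcongr
          _ = _ := by ring
      simpa using hdiff.add hmain
    have := Complex.tendsto_one_add_pow_exp_of_tendsto key
    simp only [ProbabilityMeasure.coe_mk]
    rw [charFun_gaussianReal, Real.coe_toNNReal v hv0]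
    exact this.congr fun n => (hchar n).symm

/-- The central limit theorem with a deterministic shift of the row sums. -/
theorem tendstoInDistribution_sum_add_of_bounded {E : Type*} [MeasurableSpace E] {Z : ℕ → Ω → E}
    (hZ : ∀ i, Measurable (Z i)) (hind : iIndepFun Z P) {ν : Measure E} [IsProbabilityMeasure ν]
    (hlaw : ∀ i, P.map (Z i) = ν) {ψ : ℕ → E → ℝ} (hψ : ∀ n, Measurable (ψ n)) {b d : ℕ → ℝ}
    (hb : Tendsto b atTop (𝓝 0)) (hψb : ∀ᶠ n in atTop, ∀ z, |ψ n z| ≤ b n) {μ v : ℝ}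
    (hd : Tendsto (fun n : ℕ => d n ^ 2 / n) atTop (𝓝 0))
    (hμ : Tendsto (fun n : ℕ => n * (∫ z, ψ n z ∂ν) + d n) atTop (𝓝 μ))
    (hv : Tendsto (fun n : ℕ => n * ∫ z, ψ n z ^ 2 ∂ν) atTop (𝓝 v)) :
    TendstoInDistribution (fun n ω => ∑ i ∈ Finset.range n, ψ n (Z i ω) + d n) atTop
      (id : ℝ → ℝ) (fun _ => P) (gaussianReal μ v.toNNReal) := by
  have hdn : Tendsto (fun n : ℕ => d n / n) atTop (𝓝 0) := by
    have h0 : Tendsto (fun n : ℕ => d n ^ 2 / n * (1 / (n : ℝ))) atTop (𝓝 0) := by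
      simpa using hd.mul tendsto_one_div_atTop_nhds_zero_nat
    have h1 : Tendsto (fun n : ℕ => |d n / n|) atTop (𝓝 0) := by
      have := (Real.continuous_sqrt.tendsto _).comp h0
      rw [Real.sqrt_zero] at this
      refine this.congr fun n => ?_
      rw [Function.comp_apply, ← Real.sqrt_sq_eq_abs]
      congr 1
      rw [div_pow]
      ring
    exact tendsto_zero_iff_abs_tendsto_zero _ |>.2 h1
  have i1 : ∀ᶠ n in atTop, Integrable (ψ n) ν := hψb.mono fun n hn =>
    .of_bound (hψ n).aestronglyMeasurable (b n) (.of_forall hn)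
  have i2 : ∀ᶠ n in atTop, Integrable (fun z => ψ n z ^ 2) ν := hψb.mono fun n hn =>
    .of_bound ((hψ n).pow_const 2).aestronglyMeasurable (b n ^ 2) (.of_forall fun z => by
      rw [Real.norm_eq_abs, abs_pow]
      gcongr
      exact hn z)
  -- The shift is spread evenly over the n summands. For n = 0 the sum is empty and the shift is
  -- lost, so the two row sums agree only eventually.
  have key := tendstoInDistribution_sum_of_bounded hZ hind hlaw (P := P)
    (ψ := fun n z => ψ n z + d n / n) (fun n => (hψ n).add_const _)
    (b := fun n => b n + |d n / n|) (by simpa using hb.add hdn.abs)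
    (hψb.mono fun n hn z => (abs_add_le _ _).trans (by gcongr; exact hn z)) (μ := μ) (v := v) ?_ ?_
  · have hmeas : ∀ n, AEMeasurable (fun ω => ∑ i ∈ Finset.range n, ψ n (Z i ω) + d n) P :=
      fun n => ((Finset.measurable_fun_sum _ fun i _ =>
        (hψ n).comp (hZ i)).add_const _).aemeasurable
    refine tendstoInDistribution_of_tendstoInMeasure_sub _ _ key ?_ hmeas
    refine tendstoInMeasure_of_tendsto_probFilter ?_
    refine tendsto_const_nhds.congr' ?_
    filter_upwards [tendsto_fst_probFilter.eventually (eventually_gt_atTop 0)] with z hz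
    have hz0 : (z.1 : ℝ) ≠ 0 := by positivity
    simp [Finset.sum_add_distrib, mul_div_cancel₀ _ hz0]
  · refine hμ.congr' ?_
    filter_upwards [i1, eventually_gt_atTop 0] with n hn hn0
    have hz0 : (n : ℝ) ≠ 0 := by positivity
    rw [integral_add hn (integrable_const _)]
    simp only [integral_const, probReal_univ, one_smul]
    field_simp
  -- The cross term is expressed through n ∫ ψ + d, which converges; n ∫ ψ alone may diverge.
  · have h2 : Tendsto (fun n : ℕ => n * (∫ z, ψ n z ^ 2 ∂ν)
        + 2 * (d n / n) * (n * (∫ z, ψ n z ∂ν) + d n) - d n ^ 2 / n) atTop (𝓝 v) := by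
      simpa using (hv.add ((hdn.const_mul 2).mul hμ)).sub hd
    refine h2.congr' ?_
    filter_upwards [i1, i2, eventually_gt_atTop 0] with n hn hn2 hn0
    have hz0 : (n : ℝ) ≠ 0 := by positivity
    have e : ∀ z, (ψ n z + d n / n) ^ 2
        = ψ n z ^ 2 + 2 * (d n / n) * ψ n z + (d n / n) ^ 2 := fun z => by ring
    have hn3 : Integrable (fun z => ψ n z ^ 2 + 2 * (d n / n) * ψ n z) ν :=
      hn2.add (hn.const_mul _)
    simp_rw [e]
    rw [integral_add hn3 (integrable_const _),
      integral_add hn2 (hn.const_mul _), integral_const_mul]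
    simp only [integral_const, probReal_univ, one_smul]
    field_simp
    ring

end TriangularArray

/-! ### Kernel integrals and their bias expansions. -/

section KernelIntegrals

/-- Near `x` a function continuous at `x` is bounded on the relevant range of a kernel integral. -/
theorem eventually_forall_abs_comp_le {p : ℝ → ℝ} {x : ℝ} (hp : ContinuousAt p x) :
    ∀ᶠ h in 𝓝 (0 : ℝ), ∀ u ∈ Set.Icc (-1 : ℝ) 1, |p (x - h * u)| ≤ |p x| + 1 := by
  obtain ⟨δ, hδ, hδp⟩ := Metric.continuousAt_iff.1 hp 1 one_pos
  filter_upwards [Metric.ball_mem_nhds (0 : ℝ) hδ] with h hh u hu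
  have hh' : |h| < δ := by simpa using hh
  have hu' : |u| ≤ 1 := abs_le.2 hu
  have h1 : dist (x - h * u) x < δ := by
    rw [Real.dist_eq, sub_sub_cancel_left, abs_neg, abs_mul]
    exact (mul_le_of_le_one_right (abs_nonneg h) hu').trans_lt hh'
  have h2 := hδp h1
  rw [Real.dist_eq] at h2
  have h3 := abs_add_le (p x) (p (x - h * u) - p x)
  rw [add_sub_cancel] at h3
  linarith

theorem integrable_of_continuous_of_eq_zero {k : ℝ → ℝ} (hk : Continuous k)
    (hk0 : ∀ u, u ∉ Set.Icc (-1 : ℝ) 1 → k u = 0) : Integrable k :=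
  hk.integrable_of_hasCompactSupport (.intro isCompact_Icc hk0)

theorem norm_kernel_mul_le {k p : ℝ → ℝ} (hk0 : ∀ u, u ∉ Set.Icc (-1 : ℝ) 1 → k u = 0) {x h : ℝ}
    (hh : ∀ u ∈ Set.Icc (-1 : ℝ) 1, |p (x - h * u)| ≤ |p x| + 1) (u : ℝ) :
    ‖k u * p (x - h * u)‖ ≤ |k u| * (|p x| + 1) := by
  rw [norm_mul, Real.norm_eq_abs, Real.norm_eq_abs]
  by_cases hu : u ∈ Set.Icc (-1 : ℝ) 1
  · gcongr
    exact hh u hu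
  · simp [hk0 u hu]

theorem eventually_integrable_kernel_mul {k p : ℝ → ℝ} (hk : Continuous k)
    (hk0 : ∀ u, u ∉ Set.Icc (-1 : ℝ) 1 → k u = 0) (hpm : Measurable p) {x : ℝ}
    (hp : ContinuousAt p x) : ∀ᶠ h in 𝓝 (0 : ℝ), Integrable fun u => k u * p (x - h * u) := by
  filter_upwards [eventually_forall_abs_comp_le hp] with h hh
  exact ((integrable_of_continuous_of_eq_zero hk hk0).abs.mul_const (|p x| + 1)).mono'
    (hk.measurable.mul (hpm.comp (by fun_prop))).aestronglyMeasurable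
    (.of_forall (norm_kernel_mul_le hk0 hh))

/-- A kernel integral converges as the bandwidth tends to zero. -/
theorem tendsto_integral_kernel_mul {k p : ℝ → ℝ} (hk : Continuous k)
    (hk0 : ∀ u, u ∉ Set.Icc (-1 : ℝ) 1 → k u = 0) (hpm : Measurable p) {x : ℝ}
    (hp : ContinuousAt p x) :
    Tendsto (fun h : ℝ => ∫ u, k u * p (x - h * u)) (𝓝 0) (𝓝 (p x * ∫ u, k u)) := by
  rw [mul_comm, ← integral_mul_const]
  refine tendsto_integral_filter_of_dominated_convergence (fun u => |k u| * (|p x| + 1))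
    (.of_forall fun h =>
      (hk.measurable.mul (hpm.comp (by fun_prop))).aestronglyMeasurable) ?_
    ((integrable_of_continuous_of_eq_zero hk hk0).abs.mul_const _) (.of_forall fun u => ?_)
  · filter_upwards [eventually_forall_abs_comp_le hp] with h hh
    exact .of_forall (norm_kernel_mul_le hk0 hh)
  · have h1 : Tendsto (fun h : ℝ => x - h * u) (𝓝 0) (𝓝 x) := by
      have : Continuous fun h : ℝ => x - h * u := by fun_prop
      simpa using this.tendsto 0
    exact (hp.tendsto.comp h1).const_mul _

/-- The substitution `t = x - h u` in a kernel integral. -/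
theorem integral_comp_sub_div_mul (k p : ℝ → ℝ) (x : ℝ) {h : ℝ} (hh : 0 < h) :
    ∫ t, k ((x - t) / h) * p t = h * ∫ u, k u * p (x - h * u) := by
  have h1 := Measure.integral_comp_div (fun u => k u * p (x - h * u)) h
  rw [abs_of_pos hh, smul_eq_mul] at h1
  rw [← h1, ← integral_sub_left_eq_self (fun t => k ((x - t) / h) * p t) volume x]
  refine integral_congr_ae (.of_forall fun t => ?_)
  simp only [sub_sub_cancel]
  rw [mul_div_cancel₀ _ hh.ne']

/-- The Peano remainder of second order at `x`, extended by continuity. -/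
noncomputable def secondOrderQuotient (p : ℝ → ℝ) (x s : ℝ) : ℝ :=
  if s = 0 then iteratedDeriv 2 p x / 2 else (p (x + s) - p x - deriv p x * s) / s ^ 2

theorem eq_add_secondOrderQuotient (p : ℝ → ℝ) (x s : ℝ) :
    p (x + s) = p x + deriv p x * s + s ^ 2 * secondOrderQuotient p x s := by
  unfold secondOrderQuotient
  split_ifs with h
  · simp [h]
  · field_simp
    ring

theorem measurable_secondOrderQuotient {p : ℝ → ℝ} (hp : Measurable p) (x : ℝ) :
    Measurable (secondOrderQuotient p x) :=
  Measurable.ite (measurableSet_singleton 0) measurable_const (by fun_prop)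

/-- Taylor's theorem with Peano remainder: the quotient tends to p''(x) / 2, which is the value
assigned at zero. Two derivatives at x suffice, with no third derivative for a Lagrange remainder.
-/
theorem continuousAt_secondOrderQuotient {p : ℝ → ℝ} {x : ℝ} (hp : ContDiffAt ℝ 2 p x) :
    ContinuousAt (secondOrderQuotient p x) 0 := by
  obtain ⟨u, hu, hpu⟩ := hp.contDiffOn (m := 2) le_rfl (by simp)
  obtain ⟨δ, hδ, hball⟩ := Metric.mem_nhds_iff.1 hu
  have hx : x ∈ Metric.ball x δ := Metric.mem_ball_self hδ
  have ht := taylor_tendsto (n := 2) (convex_ball x δ) hx (hpu.mono hball)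
  rw [Metric.isOpen_ball.nhdsWithin_eq hx] at ht
  have hT : ∀ y, taylorWithinEval p 2 (Metric.ball x δ) x y
      = p x + deriv p x * (y - x) + iteratedDeriv 2 p x / 2 * (y - x) ^ 2 := by
    intro y
    rw [taylorWithinEval_succ, taylorWithinEval_succ, taylor_within_zero_eval,
      iteratedDerivWithin_of_isOpen Metric.isOpen_ball hx,
      iteratedDerivWithin_of_isOpen Metric.isOpen_ball hx, iteratedDeriv_one]
    simp [Nat.factorial]
    ring
  have hs : Tendsto (fun s : ℝ => x + s) (𝓝[≠] 0) (𝓝 x) := by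
    have : Continuous fun s : ℝ => x + s := by fun_prop
    simpa using (this.tendsto 0).mono_left nhdsWithin_le_nhds
  have h1 := (ht.comp hs).add_const (iteratedDeriv 2 p x / 2)
  rw [continuousAt_iff_punctured_nhds]
  have h0 : secondOrderQuotient p x 0 = 0 + iteratedDeriv 2 p x / 2 := by
    simp [secondOrderQuotient]
  rw [h0]
  refine h1.congr' ?_
  filter_upwards [self_mem_nhdsWithin] with s hs0
  have hs0' : s ≠ 0 := hs0
  simp only [Function.comp_apply, hT, add_sub_cancel_left, smul_eq_mul, secondOrderQuotient,
    if_neg hs0']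
  field_simp
  ring

namespace ConditionW

variable {w : ℝ → ℝ} (hw : ConditionW w)

include hw

theorem eq_zero (u : ℝ) (hu : u ∉ Set.Icc (-1 : ℝ) 1) : w u = 0 := by
  by_contra h
  exact hu (hw.support_subset h)

theorem hasDerivAt (u : ℝ) : HasDerivAt w (deriv w u) u :=
  (hw.contDiff.differentiable (by norm_num) _).hasDerivAt

theorem continuous_deriv : Continuous (deriv w) := hw.contDiff.continuous_deriv (by norm_num)

theorem deriv_eq_zero (u : ℝ) (hu : u ∉ Set.Icc (-1 : ℝ) 1) : deriv w u = 0 := by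
  have : w =ᶠ[𝓝 u] fun _ => 0 := by
    filter_upwards [isClosed_Icc.isOpen_compl.mem_nhds hu] with v hv
    exact hw.eq_zero v hv
  rw [this.deriv_eq]
  simp

theorem integrable : Integrable w :=
  integrable_of_continuous_of_eq_zero hw.contDiff.continuous hw.eq_zero

/-- The integrand is odd because w is even. This removes the first order bias. -/
theorem integral_mul_id : ∫ u, w u * u = 0 := by
  have h := integral_neg_eq_self (fun u => w u * u) volume
  simp only [hw.symm, mul_neg, integral_neg] at h
  linarith

end ConditionW

/-- Second order expansion of the bias of a kernel smoother. -/
theorem tendsto_integral_kernel_sub_div {w : ℝ → ℝ} (hw : ConditionW w) {p : ℝ → ℝ}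
    (hpm : Measurable p) {x : ℝ} (hp : ContDiffAt ℝ 2 p x) :
    Tendsto (fun h : ℝ => ((∫ u, w u * p (x - h * u)) - p x) / h ^ 2) (𝓝[≠] 0)
      (𝓝 (iteratedDeriv 2 p x / 2 * ∫ v, v ^ 2 * w v)) := by
  have hwc := hw.contDiff.continuous
  have hk : Continuous fun u => w u * u ^ 2 := by fun_prop
  have hk0 : ∀ u, u ∉ Set.Icc (-1 : ℝ) 1 → w u * u ^ 2 = 0 := fun u hu => by
    simp [hw.eq_zero u hu]
  have hqm := measurable_secondOrderQuotient hpm x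
  have hqc := continuousAt_secondOrderQuotient hp
  have h1 := tendsto_integral_kernel_mul hk hk0 hqm hqc
  have h0 : secondOrderQuotient p x 0 = iteratedDeriv 2 p x / 2 := by simp [secondOrderQuotient]
  have hcomm : ∫ v, v ^ 2 * w v = ∫ v, w v * v ^ 2 := by simp_rw [mul_comm]
  rw [hcomm, ← h0]
  refine (h1.mono_left nhdsWithin_le_nhds).congr' ?_
  filter_upwards [self_mem_nhdsWithin,
    (eventually_integrable_kernel_mul hk hk0 hqm hqc).filter_mono nhdsWithin_le_nhds] with h hh hi
  have hh0 : h ≠ 0 := hh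
  -- The Taylor remainder is itself a kernel integral, with kernel w(u) u² and the continuously
  -- extended quotient as integrand.
  have e : ∀ u, w u * p (x - h * u) = w u * p x + (-(deriv p x * h)) * (w u * u)
      + h ^ 2 * (w u * u ^ 2 * secondOrderQuotient p x (0 - h * u)) := by
    intro u
    rw [sub_eq_add_neg, eq_add_secondOrderQuotient p, zero_sub]
    ring
  have i1 : Integrable fun u => w u * p x := hw.integrable.mul_const _
  have i2 : Integrable fun u => (-(deriv p x * h)) * (w u * u) :=
    (integrable_of_continuous_of_eq_zero (by fun_prop) fun u hu => by
      simp [hw.eq_zero u hu]).const_mul _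
  have i12 : Integrable fun u => w u * p x + (-(deriv p x * h)) * (w u * u) := i1.add i2
  simp_rw [e]
  rw [integral_add i12 (hi.const_mul _), integral_add i1 i2, integral_const_mul,
    integral_const_mul, integral_mul_const, hw.integral_eq_one, hw.integral_mul_id]
  field_simp
  ring_nf

/-- Integration by parts moves the derivative from the kernel to the density. -/
theorem eventually_integral_deriv_kernel {w : ℝ → ℝ} (hw : ConditionW w) {p : ℝ → ℝ} {x : ℝ}
    (hp : ContDiffAt ℝ 1 p x) : ∀ᶠ h in 𝓝 (0 : ℝ),
      ∫ u, deriv w u * p (x - h * u) = h * ∫ u, w u * deriv p (x - h * u) := by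
  obtain ⟨δ, hδ, hball⟩ := Metric.eventually_nhds_iff_ball.1 (hp.eventually (by simp))
  -- Half of δ suffices since |u| ≤ 2 below. The interval [-2, 2] has the support of w in its
  -- interior, so the boundary terms vanish.
  filter_upwards [Metric.ball_mem_nhds (0 : ℝ) (half_pos hδ)] with h hh
  have hh' : |h| < δ / 2 := by simpa using hh
  have hmem : ∀ u ∈ Set.uIcc (-2 : ℝ) 2, ContDiffAt ℝ 1 p (x - h * u) := by
    intro u hu
    rw [Set.uIcc_of_le (by norm_num)] at hu
    refine hball _ ?_
    rw [Metric.mem_ball, Real.dist_eq, sub_sub_cancel_left, abs_neg, abs_mul]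
    have := abs_le.2 hu
    nlinarith [abs_nonneg h, abs_nonneg u]
  have hsub : ∀ k : ℝ → ℝ, (∀ u, u ∉ Set.Icc (-1 : ℝ) 1 → k u = 0) →
      Function.support k ⊆ Set.Ioc (-2) 2 := by
    intro k hk u hu
    have : u ∈ Set.Icc (-1 : ℝ) 1 := by
      by_contra hc
      exact hu (hk u hc)
    exact ⟨by linarith [this.1], by linarith [this.2]⟩
  have hparts := intervalIntegral.integral_mul_deriv_eq_deriv_mul (a := -2) (b := 2)
    (u := fun u => p (x - h * u)) (u' := fun u => deriv p (x - h * u) * (-h)) (v := w)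
    (v' := deriv w) ?_ (fun u _ => hw.hasDerivAt u) ?_
    hw.continuous_deriv.continuousOn.intervalIntegrable
  · rw [intervalIntegral.integral_eq_integral_of_support_subset
      (hsub _ fun u hu => by simp [hw.deriv_eq_zero u hu]),
      intervalIntegral.integral_eq_integral_of_support_subset
      (hsub _ fun u hu => by simp [hw.eq_zero u hu]), hw.eq_zero 2 (by norm_num),
      hw.eq_zero (-2) (by norm_num)] at hparts
    calc ∫ u, deriv w u * p (x - h * u) = ∫ u, p (x - h * u) * deriv w u := by
          simp_rw [mul_comm]
      _ = -∫ u, deriv p (x - h * u) * (-h) * w u := by rw [hparts]; ring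
      _ = ∫ u, h * (w u * deriv p (x - h * u)) := by
          rw [← integral_neg]
          congr 1
          ext u
          ring
      _ = _ := integral_const_mul _ _
  · intro u hu
    have h1 : HasDerivAt (fun u : ℝ => x - h * u) (-h) u := by
      simpa using ((hasDerivAt_id u).const_mul h).const_sub x
    exact ((hmem u hu).differentiableAt (by simp)).hasDerivAt.comp u h1
  · refine ContinuousOn.intervalIntegrable fun u hu => ContinuousAt.continuousWithinAt ?_
    have hc : ContinuousAt (deriv p) (x - h * u) := 
      ((hmem u hu).derivWithin (m := 0) (by simp)).continuousAt
    exact ((hc.comp (f := fun u : ℝ => x - h * u) (by fun_prop)).mul continuousAt_const)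

/-- Second order expansion of the bias of the derivative of a kernel smoother. -/
theorem tendsto_integral_deriv_kernel_sub_div {w : ℝ → ℝ} (hw : ConditionW w) {p : ℝ → ℝ} {x : ℝ}
    (hp : ContDiffAt ℝ 3 p x) :
    Tendsto (fun h : ℝ => (h⁻¹ * (∫ u, deriv w u * p (x - h * u)) - deriv p x) / h ^ 2) (𝓝[≠] 0)
      (𝓝 (iteratedDeriv 3 p x / 2 * ∫ v, v ^ 2 * w v)) := by
  have hd : ContDiffAt ℝ 2 (deriv p) x := hp.derivWithin (by norm_num)
  have h1 := tendsto_integral_kernel_sub_div hw (measurable_deriv p) hd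
  rw [← iteratedDeriv_succ'] at h1
  refine h1.congr' ?_
  filter_upwards [self_mem_nhdsWithin, (eventually_integral_deriv_kernel hw
    (hp.of_le (by norm_num))).filter_mono nhdsWithin_le_nhds] with h hh he
  have hh0 : h ≠ 0 := hh
  rw [he, inv_mul_cancel_left₀ hh0]

end KernelIntegrals

/-! ### Mean square error of sample means. -/

/-- The sequence `Z` is an i.i.d. sample from the distribution `ν`. -/
structure IsIIDSample {Ω E : Type*} [MeasurableSpace Ω] [MeasurableSpace E] (Z : ℕ → Ω → E)
    (ν : Measure E) (P : Measure Ω) : Prop where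
  measurable : ∀ i, Measurable (Z i)
  indep : iIndepFun Z P
  law : ∀ i, P.map (Z i) = ν

section MeanSquare

variable {Ω E : Type*} [MeasurableSpace Ω] [MeasurableSpace E] {P : Measure Ω}
  [IsProbabilityMeasure P] {Z : ℕ → Ω → E} {ν : Measure E}

/-- Mean square error of a sample mean. -/
theorem IsIIDSample.lintegral_sq_mean_sub_le (hZ : IsIIDSample Z ν P) {ψ : E → ℝ}
    (hψ : Measurable ψ) {C : ℝ} (hC : ∀ z, |ψ z| ≤ C) {n : ℕ} (hn : 0 < n) (r b : ℝ) :
    ∫⁻ ω, ENNReal.ofReal ((r * (1 / (n : ℝ) * ∑ i ∈ Finset.range n, ψ (Z i ω)) - b) ^ 2) ∂P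
      ≤ ENNReal.ofReal (r ^ 2 / n * (∫ z, ψ z ^ 2 ∂ν) + (r * (∫ z, ψ z ∂ν) - b) ^ 2) := by
  have hn0 : (n : ℝ) ≠ 0 := by positivity
  have hm : ∀ i, Measurable fun ω => ψ (Z i ω) := fun i => hψ.comp (hZ.measurable i)
  have hL : ∀ i, MemLp (fun ω => ψ (Z i ω)) 2 P := fun i =>
    .of_bound (hm i).aestronglyMeasurable C (.of_forall fun ω => hC _)
  have hE : ∀ i, ∫ ω, ψ (Z i ω) ∂P = ∫ z, ψ z ∂ν := fun i => by
    rw [← hZ.law i, integral_map (hZ.measurable i).aemeasurable hψ.aestronglyMeasurable]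
  have hE2 : ∀ i, ∫ ω, ψ (Z i ω) ^ 2 ∂P = ∫ z, ψ z ^ 2 ∂ν := fun i => by
    rw [← hZ.law i,
      integral_map (hZ.measurable i).aemeasurable (hψ.pow_const 2).aestronglyMeasurable]
  have hSL : MemLp (fun ω => ∑ i ∈ Finset.range n, ψ (Z i ω)) 2 P :=
    memLp_finsetSum _ fun i _ => hL i
  -- Bounding each variance by the raw second moment is enough: only the order of the variance is
  -- needed from this bound.
  have hvar : variance (fun ω => ∑ i ∈ Finset.range n, ψ (Z i ω)) P ≤ n * ∫ z, ψ z ^ 2 ∂ν := by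
    have hind := hZ.indep.comp (fun _ => ψ) fun _ => hψ
    have e := IndepFun.variance_sum (μ := P) (X := fun i ω => ψ (Z i ω)) (s := Finset.range n)
      (fun i _ => hL i) fun i _ j _ hij => hind.indepFun hij
    have e' : (∑ i ∈ Finset.range n, fun ω => ψ (Z i ω))
        = fun ω => ∑ i ∈ Finset.range n, ψ (Z i ω) := by
      ext ω
      simp
    rw [e'] at e
    rw [e]
    calc ∑ i ∈ Finset.range n, variance (fun ω => ψ (Z i ω)) P
        ≤ ∑ i ∈ Finset.range n, ∫ z, ψ z ^ 2 ∂ν := Finset.sum_le_sum fun i _ => by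
          rw [← hE2 i]
          exact variance_le_expectation_sq (hm i).aestronglyMeasurable
      _ = n * ∫ z, ψ z ^ 2 ∂ν := by simp
  set Y : Ω → ℝ := fun ω => r * (1 / (n : ℝ) * ∑ i ∈ Finset.range n, ψ (Z i ω)) - b with hY
  have hY' : Y = fun ω => (r / n) * (∑ i ∈ Finset.range n, ψ (Z i ω)) - b := by
    ext ω
    rw [hY]
    ring
  have hYL : MemLp Y 2 P := by
    rw [hY']
    exact (hSL.const_mul _).sub (memLp_const b)
  have hEY : ∫ ω, Y ω ∂P = r * (∫ z, ψ z ∂ν) - b := by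
    rw [hY', integral_sub ((hSL.integrable (by norm_num)).const_mul _) (integrable_const _),
      integral_const_mul, integral_finsetSum _ fun i _ => (hL i).integrable (by norm_num)]
    simp only [hE, Finset.sum_const, Finset.card_range, nsmul_eq_mul, integral_const,
      probReal_univ, one_smul]
    field_simp
  have hVY : variance Y P ≤ r ^ 2 / n * ∫ z, ψ z ^ 2 ∂ν := by
    rw [hY', variance_sub_const ((hSL.const_mul _).aestronglyMeasurable), variance_const_mul]
    calc (r / n) ^ 2 * _ ≤ (r / n) ^ 2 * (n * ∫ z, ψ z ^ 2 ∂ν) := by gcongr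
      _ = _ := by field_simp
  rw [← ofReal_integral_eq_lintegral_ofReal hYL.integrable_sq (.of_forall fun _ => sq_nonneg _)]
  refine ENNReal.ofReal_le_ofReal ?_
  have h1 := variance_eq_sub hYL
  rw [hEY] at h1
  have h2 : ∫ ω, Y ω ^ 2 ∂P = P[Y ^ 2] := rfl
  linarith

end MeanSquare

/-! ### Weighted kernels and their moments. -/

/-- The weight `α 1_{X ≤ T} + β` of the observation `z = (X, T)`. -/
noncomputable def obsWeight (α β : ℝ) (z : ℝ × ℝ) : ℝ := (if z.1 ≤ z.2 then α else 0) + β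

/-- The mean of `α 1_{X ≤ T} + β` given `T = t`, times the density of `T`. -/
noncomputable def weightedDensity (F q : ℝ → ℝ) (α β t : ℝ) : ℝ := (α * F t + β) * q t

/-- The kernel average `(1 / n) ∑ h⁻ʲ k ((x - T_i) / h) (α 1_{X_i ≤ T_i} + β)`. -/
noncomputable def kernelAvg (k : ℝ → ℝ) (j : ℕ) (α β : ℝ) (n : ℕ) (h : ℝ) (Z : ℕ → ℝ × ℝ)
    (x : ℝ) : ℝ :=
  1 / (n : ℝ) * ∑ i ∈ Finset.range n,
    1 / h ^ j * (k ((x - (Z i).2) / h) * obsWeight α β (Z i))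

section Weights

theorem measurable_obsWeight (α β : ℝ) : Measurable (obsWeight α β) :=
  (Measurable.ite (measurableSet_le measurable_fst measurable_snd) measurable_const
    measurable_const).add_const β

theorem abs_obsWeight_le (α β : ℝ) (z : ℝ × ℝ) : |obsWeight α β z| ≤ |α| + |β| := by
  unfold obsWeight
  split_ifs
  · exact abs_add_le _ _
  · simp

/-- An indicator is idempotent, so the weights are closed under squaring, and second moments follow
from the formula for means. -/
theorem obsWeight_sq (α β : ℝ) (z : ℝ × ℝ) :
    obsWeight α β z ^ 2 = obsWeight (α ^ 2 + 2 * α * β) (β ^ 2) z := by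
  unfold obsWeight
  split_ifs <;> ring

theorem exists_abs_le_of_continuous_of_eq_zero {k : ℝ → ℝ} (hk : Continuous k)
    (hk0 : ∀ u, u ∉ Set.Icc (-1 : ℝ) 1 → k u = 0) : ∃ K, ∀ u, |k u| ≤ K := by
  obtain ⟨K, hK⟩ := hk.bounded_above_of_compact_support (.intro isCompact_Icc hk0)
  exact ⟨K, fun u => hK u⟩

theorem measurable_kernel_mul_obsWeight {k : ℝ → ℝ} (hk : Continuous k) (α β x h : ℝ) :
    Measurable fun z : ℝ × ℝ => k ((x - z.2) / h) * obsWeight α β z :=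
  (hk.measurable.comp (by fun_prop)).mul (measurable_obsWeight α β)

theorem abs_kernel_mul_obsWeight_le {k : ℝ → ℝ} {K : ℝ} (hK : ∀ u, |k u| ≤ K) (α β x h : ℝ)
    (z : ℝ × ℝ) : |k ((x - z.2) / h) * obsWeight α β z| ≤ K * (|α| + |β|) := by
  rw [abs_mul]
  exact mul_le_mul (hK _) (abs_obsWeight_le α β z) (abs_nonneg _) ((abs_nonneg _).trans (hK 0))

variable {μX : Measure ℝ} [IsProbabilityMeasure μX] {F q : ℝ → ℝ}

theorem measurable_weightedDensity (hF : ∀ t, F t = μX.real (Set.Iic t)) (hq : Measurable q)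
    (α β : ℝ) : Measurable (weightedDensity F q α β) := by
  have hFm : Measurable F := by
    refine Monotone.measurable fun s t hst => ?_
    rw [hF, hF]
    exact measureReal_mono (Set.Iic_subset_Iic.2 hst)
  unfold weightedDensity
  fun_prop

variable [IsProbabilityMeasure (volume.withDensity fun t => ENNReal.ofReal (q t))]

/-- Expectation of a function of `T` times `α 1_{X ≤ T} + β`, for independent `X` and `T`. -/
theorem integral_mul_obsWeight (hF : ∀ t, F t = μX.real (Set.Iic t)) (hq : Measurable q)
    (hq0 : ∀ t, 0 ≤ q t) {g : ℝ → ℝ} (hg : Measurable g) {C : ℝ} (hC : ∀ t, |g t| ≤ C)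
    (α β : ℝ) :
    ∫ z, g z.2 * obsWeight α β z ∂(μX.prod (volume.withDensity fun t => ENNReal.ofReal (q t)))
      = ∫ t, g t * weightedDensity F q α β t := by
  have hC0 : 0 ≤ C := (abs_nonneg _).trans (hC 0)
  have hint : Integrable (fun z : ℝ × ℝ => g z.2 * obsWeight α β z)
      (μX.prod (volume.withDensity fun t => ENNReal.ofReal (q t))) := by
    refine .of_bound ((hg.comp measurable_snd).mul
      (measurable_obsWeight α β)).aestronglyMeasurable (C * (|α| + |β|)) (.of_forall fun z => ?_)
    rw [Real.norm_eq_abs, abs_mul]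
    exact mul_le_mul (hC _) (abs_obsWeight_le α β z) (abs_nonneg _) hC0
  rw [integral_prod_symm _ hint,
    integral_withDensity_eq_integral_toReal_smul hq.ennreal_ofReal
      (.of_forall fun _ => ENNReal.ofReal_lt_top)]
  refine integral_congr_ae (.of_forall fun t => ?_)
  have h1 : ∫ s, obsWeight α β (s, t) ∂μX = α * F t + β := by
    have e : (fun s => obsWeight α β (s, t))
        = fun s => (Set.Iic t).indicator (fun _ => α) s + β := by
      ext s
      simp [obsWeight, Set.indicator_apply]
    rw [e, integral_add ((integrable_const α).indicator measurableSet_Iic) (integrable_const β),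
      integral_indicator_const _ measurableSet_Iic, hF]
    simp [mul_comm]
  simp only [integral_const_mul, h1, weightedDensity, ENNReal.toReal_ofReal (hq0 t), smul_eq_mul]
  ring

theorem integral_kernel_mul_obsWeight (hF : ∀ t, F t = μX.real (Set.Iic t)) (hq : Measurable q)
    (hq0 : ∀ t, 0 ≤ q t) {k : ℝ → ℝ} (hk : Continuous k)
    (hk0 : ∀ u, u ∉ Set.Icc (-1 : ℝ) 1 → k u = 0) (α β x : ℝ) {h : ℝ} (hh : 0 < h) :
    ∫ z, k ((x - z.2) / h) * obsWeight α β z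
        ∂(μX.prod (volume.withDensity fun t => ENNReal.ofReal (q t)))
      = h * ∫ u, k u * weightedDensity F q α β (x - h * u) := by
  obtain ⟨K, hK⟩ := exists_abs_le_of_continuous_of_eq_zero hk hk0
  rw [integral_mul_obsWeight hF hq hq0 (g := fun t => k ((x - t) / h))
    (hk.measurable.comp (by fun_prop)) (fun t => hK _), integral_comp_sub_div_mul _ _ _ hh]

theorem integral_kernel_mul_obsWeight_sq (hF : ∀ t, F t = μX.real (Set.Iic t))
    (hq : Measurable q) (hq0 : ∀ t, 0 ≤ q t) {k : ℝ → ℝ} (hk : Continuous k)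
    (hk0 : ∀ u, u ∉ Set.Icc (-1 : ℝ) 1 → k u = 0) (α β x : ℝ) {h : ℝ} (hh : 0 < h) :
    ∫ z, (k ((x - z.2) / h) * obsWeight α β z) ^ 2
        ∂(μX.prod (volume.withDensity fun t => ENNReal.ofReal (q t)))
      = h * ∫ u, k u ^ 2 * weightedDensity F q (α ^ 2 + 2 * α * β) (β ^ 2) (x - h * u) := by
  simp_rw [mul_pow, obsWeight_sq]
  exact integral_kernel_mul_obsWeight hF hq hq0 (k := fun u => k u ^ 2) (by fun_prop)
    (fun u hu => by simp [hk0 u hu]) _ _ x hh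

end Weights

/-! ### Limit theorems for kernel averages. -/

section KernelAverages

variable {Ω : Type*} [MeasurableSpace Ω] {P : Measure Ω}
  {Z : ℕ → Ω → ℝ × ℝ} {μX : Measure ℝ} {F q : ℝ → ℝ}

theorem measurable_kernelAvg (hZ : ∀ i, Measurable (Z i)) {k : ℝ → ℝ} (hk : Continuous k)
    (j : ℕ) (α β : ℝ) (n : ℕ) (h x : ℝ) :
    Measurable fun ω => kernelAvg k j α β n h (fun i => Z i ω) x :=
  (Finset.measurable_fun_sum _ fun i _ =>
    ((measurable_kernel_mul_obsWeight hk α β x h).comp (hZ i)).const_mul _).const_mul _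

theorem continuousAt_weightedDensity {x : ℝ} (hF : ContinuousAt F x) (hq : ContinuousAt q x)
    (α β : ℝ) : ContinuousAt (weightedDensity F q α β) x := by
  unfold weightedDensity
  fun_prop

variable [IsProbabilityMeasure P] [IsProbabilityMeasure μX]
  [IsProbabilityMeasure (volume.withDensity fun t => ENNReal.ofReal (q t))]

/-- Mean square bound for a kernel average, with the limit of the bound. -/
theorem exists_tendsto_lintegral_sq_kernelAvg_le
    (hZ : IsIIDSample Z (μX.prod (volume.withDensity fun t => ENNReal.ofReal (q t))) P)
    (hF : ∀ t, F t = μX.real (Set.Iic t)) (hq : Measurable q) (hq0 : ∀ t, 0 ≤ q t) {x : ℝ}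
    (hFx : ContinuousAt F x) (hqx : ContinuousAt q x) {k : ℝ → ℝ} (hk : Continuous k)
    (hk0 : ∀ u, u ∉ Set.Icc (-1 : ℝ) 1 → k u = 0) {j : ℕ} {α β θ l : ℝ}
    (hbias : Tendsto (fun h : ℝ => (1 / h ^ j * (h * ∫ u, k u *
      weightedDensity F q α β (x - h * u)) - θ) / h ^ 2) (𝓝[>] 0) (𝓝 l))
    {r h : ℕ → ℝ} (hh : Tendsto h atTop (𝓝[>] 0)) {γ B : ℝ}
    (hγ : Tendsto (fun n : ℕ => r n ^ 2 / n * ((1 / h n ^ j) ^ 2 * h n)) atTop (𝓝 γ))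
    (hB : Tendsto (fun n => r n * h n ^ 2) atTop (𝓝 B)) (c : ℝ) :
    ∃ (u : ℕ → ℝ) (K : ℝ), Tendsto u atTop (𝓝 (γ * K + (B * l - c) ^ 2)) ∧
      ∀ᶠ n in atTop, ∫⁻ ω, ENNReal.ofReal
        ((r n * (kernelAvg k j α β n (h n) (fun i => Z i ω) x - θ) - c) ^ 2) ∂P
        ≤ ENNReal.ofReal (u n) := by
  obtain ⟨K, hK⟩ := exists_abs_le_of_continuous_of_eq_zero hk hk0
  have hJ2 := (tendsto_integral_kernel_mul (k := fun u => k u ^ 2) (by fun_prop)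
    (fun u hu => by simp [hk0 u hu])
    (measurable_weightedDensity hF hq (α ^ 2 + 2 * α * β) (β ^ 2))
    (continuousAt_weightedDensity hFx hqx _ _)).comp (hh.mono_right nhdsWithin_le_nhds)
  have hh0 : ∀ᶠ n in atTop, 0 < h n := hh.eventually self_mem_nhdsWithin
  refine ⟨_, _, (hγ.mul hJ2).add (((hB.mul (hbias.comp hh)).sub_const c).pow 2), ?_⟩
  filter_upwards [hh0, eventually_gt_atTop 0] with n hhn hn
  -- Centring at r θ + c leaves the variance term plus the squared distance of the scaled bias from
  -- c. Boundedness uses c = 0, convergence in probability uses c = B l.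
  have h1 := hZ.lintegral_sq_mean_sub_le
    (ψ := fun z => 1 / h n ^ j * (k ((x - z.2) / h n) * obsWeight α β z))
    ((measurable_kernel_mul_obsWeight hk α β x (h n)).const_mul _)
    (C := 1 / h n ^ j * (K * (|α| + |β|))) (fun z => by
      rw [abs_mul, abs_of_pos (show (0 : ℝ) < 1 / h n ^ j by positivity)]
      gcongr
      exact abs_kernel_mul_obsWeight_le hK α β x (h n) z) hn (r n) (r n * θ + c)
  have e2 : ∫ z, (1 / h n ^ j * (k ((x - z.2) / h n) * obsWeight α β z)) ^ 2
      ∂(μX.prod (volume.withDensity fun t => ENNReal.ofReal (q t)))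
      = (1 / h n ^ j) ^ 2 * (h n * ∫ u, k u ^ 2 *
        weightedDensity F q (α ^ 2 + 2 * α * β) (β ^ 2) (x - h n * u)) := by
    rw [← integral_kernel_mul_obsWeight_sq hF hq hq0 hk hk0 α β x hhn, ← integral_const_mul]
    simp_rw [mul_pow]
  rw [integral_const_mul, integral_kernel_mul_obsWeight hF hq hq0 hk hk0 α β x hhn, e2] at h1
  refine le_trans (le_of_eq ?_) (h1.trans (ENNReal.ofReal_le_ofReal (le_of_eq ?_)))
  · congr 1
    ext ω
    rw [kernelAvg]
    ring_nf
  · simp only [Function.comp_apply]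
    field_simp
    ring

/-- A normalized kernel average is bounded in mean square. -/
theorem exists_lintegral_sq_kernelAvg_le
    (hZ : IsIIDSample Z (μX.prod (volume.withDensity fun t => ENNReal.ofReal (q t))) P)
    (hF : ∀ t, F t = μX.real (Set.Iic t)) (hq : Measurable q) (hq0 : ∀ t, 0 ≤ q t) {x : ℝ}
    (hFx : ContinuousAt F x) (hqx : ContinuousAt q x) {k : ℝ → ℝ} (hk : Continuous k)
    (hk0 : ∀ u, u ∉ Set.Icc (-1 : ℝ) 1 → k u = 0) {j : ℕ} {α β θ l : ℝ}
    (hbias : Tendsto (fun h : ℝ => (1 / h ^ j * (h * ∫ u, k u *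
      weightedDensity F q α β (x - h * u)) - θ) / h ^ 2) (𝓝[>] 0) (𝓝 l))
    {r h : ℕ → ℝ} (hh : Tendsto h atTop (𝓝[>] 0)) {γ B : ℝ}
    (hγ : Tendsto (fun n : ℕ => r n ^ 2 / n * ((1 / h n ^ j) ^ 2 * h n)) atTop (𝓝 γ))
    (hB : Tendsto (fun n => r n * h n ^ 2) atTop (𝓝 B)) :
    ∃ C : ℝ, ∀ᶠ n in atTop, ∫⁻ ω, ENNReal.ofReal
        ((r n * (kernelAvg k j α β n (h n) (fun i => Z i ω) x - θ)) ^ 2) ∂P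
        ≤ ENNReal.ofReal C := by
  obtain ⟨u, K, hu, hle⟩ := exists_tendsto_lintegral_sq_kernelAvg_le hZ hF hq hq0 hFx hqx hk hk0
    hbias hh hγ hB 0
  refine ⟨γ * K + (B * l - 0) ^ 2 + 1, ?_⟩
  filter_upwards [hle, hu.eventually_lt_const (lt_add_one _)] with n hn hun
  simp only [sub_zero] at hn
  exact hn.trans (ENNReal.ofReal_le_ofReal (by simpa using hun.le))

/-- A normalized kernel average with asymptotically negligible variance converges in probability
to its asymptotic bias. -/
theorem tendsto_probFilter_kernelAvg
    (hZ : IsIIDSample Z (μX.prod (volume.withDensity fun t => ENNReal.ofReal (q t))) P)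
    (hF : ∀ t, F t = μX.real (Set.Iic t)) (hq : Measurable q) (hq0 : ∀ t, 0 ≤ q t) {x : ℝ}
    (hFx : ContinuousAt F x) (hqx : ContinuousAt q x) {k : ℝ → ℝ} (hk : Continuous k)
    (hk0 : ∀ u, u ∉ Set.Icc (-1 : ℝ) 1 → k u = 0) {j : ℕ} {α β θ l : ℝ}
    (hbias : Tendsto (fun h : ℝ => (1 / h ^ j * (h * ∫ u, k u *
      weightedDensity F q α β (x - h * u)) - θ) / h ^ 2) (𝓝[>] 0) (𝓝 l))
    {r h : ℕ → ℝ} (hh : Tendsto h atTop (𝓝[>] 0)) {B : ℝ}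
    (hγ : Tendsto (fun n : ℕ => r n ^ 2 / n * ((1 / h n ^ j) ^ 2 * h n)) atTop (𝓝 0))
    (hB : Tendsto (fun n => r n * h n ^ 2) atTop (𝓝 B)) :
    Tendsto (fun z : ℕ × Ω =>
      r z.1 * (kernelAvg k j α β z.1 (h z.1) (fun i => Z i z.2) x - θ)) (probFilter P)
      (𝓝 (B * l)) := by
  obtain ⟨u, K, hu, hle⟩ := exists_tendsto_lintegral_sq_kernelAvg_le hZ hF hq hq0 hFx hqx hk hk0
    hbias hh hγ hB (B * l)
  have hu0 : Tendsto (fun n => ENNReal.ofReal (u n)) atTop (𝓝 0) := by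
    rw [← ENNReal.ofReal_zero]
    refine ENNReal.tendsto_ofReal ?_
    simpa using hu
  have h1 := tendsto_probFilter_of_lintegral_sq (P := P)
    (Y := fun n ω => r n * (kernelAvg k j α β n (h n) (fun i => Z i ω) x - θ) - B * l)
    (fun n => (((measurable_kernelAvg hZ.measurable hk j α β n (h n) x).sub_const θ).const_mul
      _).sub_const _)
    (tendsto_of_tendsto_of_tendsto_of_le_of_le' tendsto_const_nhds hu0
      (.of_forall fun _ => zero_le) hle)
  simpa using h1.add_const (B * l)

/-- Central limit theorem for the kernel averages with factor `h⁻²`. -/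
theorem tendstoInDistribution_kernelAvg
    (hZ : IsIIDSample Z (μX.prod (volume.withDensity fun t => ENNReal.ofReal (q t))) P)
    (hF : ∀ t, F t = μX.real (Set.Iic t)) (hq : Measurable q) (hq0 : ∀ t, 0 ≤ q t) {x : ℝ}
    (hFx : ContinuousAt F x) (hqx : ContinuousAt q x) {k : ℝ → ℝ} (hk : Continuous k)
    (hk0 : ∀ u, u ∉ Set.Icc (-1 : ℝ) 1 → k u = 0) {α β θ l : ℝ}
    (hbias : Tendsto (fun h : ℝ => (1 / h ^ 2 * (h * ∫ u, k u *
      weightedDensity F q α β (x - h * u)) - θ) / h ^ 2) (𝓝[>] 0) (𝓝 l))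
    {r h : ℕ → ℝ} (hh : Tendsto h atTop (𝓝[>] 0)) {γ B : ℝ}
    (hγ : Tendsto (fun n : ℕ => r n ^ 2 / n * ((1 / h n ^ 2) ^ 2 * h n)) atTop (𝓝 γ))
    (hB : Tendsto (fun n => r n * h n ^ 2) atTop (𝓝 B))
    (hnh : Tendsto (fun n : ℕ => n * h n) atTop atTop) (c : ℝ) :
    TendstoInDistribution (fun n ω =>
        r n * (kernelAvg k 2 α β n (h n) (fun i => Z i ω) x - θ) + c)
      atTop (id : ℝ → ℝ) (fun _ => P) (gaussianReal (B * l + c)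
        (γ * (weightedDensity F q (α ^ 2 + 2 * α * β) (β ^ 2) x * ∫ u, k u ^ 2)).toNNReal) := by
  obtain ⟨K, hK⟩ := exists_abs_le_of_continuous_of_eq_zero hk hk0
  have hh' : Tendsto h atTop (𝓝 0) := hh.mono_right nhdsWithin_le_nhds
  have hh0 : ∀ᶠ n in atTop, 0 < h n := hh.eventually self_mem_nhdsWithin
  have hJ2 := (tendsto_integral_kernel_mul (k := fun u => k u ^ 2) (by fun_prop)
    (fun u hu => by simp [hk0 u hu])
    (measurable_weightedDensity hF hq (α ^ 2 + 2 * α * β) (β ^ 2))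
    (continuousAt_weightedDensity hFx hqx _ _)).comp hh'
  have hr2 : Tendsto (fun n : ℕ => r n ^ 2 / n) atTop (𝓝 0) := by
    have h1 : Tendsto (fun n : ℕ => r n ^ 2 / n * ((1 / h n ^ 2) ^ 2 * h n) * h n ^ 3) atTop
        (𝓝 0) := by simpa using hγ.mul (hh'.pow 3)
    refine h1.congr' ?_
    filter_upwards [hh0] with n hn
    field_simp
  -- The square of this uniform bound on the summands is the variance factor r² / (n h³) times 1 /
  -- (n h).
  have hbn : Tendsto (fun n : ℕ => |r n| / n * (1 / h n ^ 2)) atTop (𝓝 0) := by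
    have h1 : Tendsto (fun n : ℕ => r n ^ 2 / n * ((1 / h n ^ 2) ^ 2 * h n) * (n * h n)⁻¹) atTop
        (𝓝 0) := by simpa using hγ.mul (tendsto_inv_atTop_zero.comp hnh)
    have h2 := (Real.continuous_sqrt.tendsto _).comp h1
    rw [Real.sqrt_zero] at h2
    refine h2.congr' ?_
    filter_upwards [hh0, eventually_gt_atTop 0] with n hn hn0
    have hn1 : (0 : ℝ) < n := by positivity
    have e : r n ^ 2 / n * ((1 / h n ^ 2) ^ 2 * h n) * (n * h n)⁻¹
        = (|r n| / n * (1 / h n ^ 2)) ^ 2 := by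
      rw [mul_pow (|r n| / n), div_pow |r n|, sq_abs]
      field_simp
    rw [Function.comp_apply, e, Real.sqrt_sq (by positivity)]
  -- The centring r θ may diverge, so it enters as the shift d = c - r θ; this is allowed because r²
  -- / n → 0.
  have key := tendstoInDistribution_sum_add_of_bounded hZ.measurable hZ.indep hZ.law
    (ψ := fun n z => r n / n * (1 / h n ^ 2 * (k ((x - z.2) / h n) * obsWeight α β z)))
    (fun n => ((measurable_kernel_mul_obsWeight hk α β x (h n)).const_mul _).const_mul _)
    (b := fun n => |r n| / n * (1 / h n ^ 2) * (K * (|α| + |β|)))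
    (d := fun n => c - r n * θ) (by simpa using hbn.mul_const (K * (|α| + |β|))) ?_
    (μ := B * l + c)
    (v := γ * (weightedDensity F q (α ^ 2 + 2 * α * β) (β ^ 2) x * ∫ u, k u ^ 2)) ?_ ?_ ?_
  · convert key using 3 with n ω
    simp only [kernelAvg, ← Finset.mul_sum]
    ring
  · filter_upwards [hh0] with n hn z
    rw [abs_mul, abs_mul, abs_div, Nat.abs_cast,
      abs_of_pos (show (0 : ℝ) < 1 / h n ^ 2 by positivity), mul_assoc]
    gcongr
    exact abs_kernel_mul_obsWeight_le hK α β x (h n) z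
  · have h1 : Tendsto (fun n : ℕ => c ^ 2 * (1 / (n : ℝ)) + θ ^ 2 * (r n ^ 2 / n)
        - 2 * c * θ * (r n / n)) atTop (𝓝 0) := by
      have h2 : Tendsto (fun n : ℕ => r n / n) atTop (𝓝 0) := by
        rw [tendsto_zero_iff_abs_tendsto_zero]
        have h3 : Tendsto (fun n : ℕ => |r n| / n * (1 / h n ^ 2) * h n ^ 2) atTop (𝓝 0) := by
          simpa using hbn.mul (hh'.pow 2)
        refine h3.congr' ?_
        filter_upwards [hh0] with n hn
        simp only [Function.comp_apply, abs_div, Nat.abs_cast]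
        field_simp
      simpa using ((tendsto_one_div_atTop_nhds_zero_nat.const_mul (c ^ 2)).add
        (hr2.const_mul (θ ^ 2))).sub (h2.const_mul (2 * c * θ))
    refine h1.congr fun n => ?_
    ring
  · refine ((hB.mul (hbias.comp hh)).add_const c).congr' ?_
    filter_upwards [hh0, eventually_gt_atTop 0] with n hn hn0
    rw [integral_const_mul, integral_const_mul,
      integral_kernel_mul_obsWeight hF hq hq0 hk hk0 α β x hn]
    simp only [Function.comp_apply]
    field_simp
    ring
  · refine (hγ.mul hJ2).congr' ?_
    filter_upwards [hh0, eventually_gt_atTop 0] with n hn hn0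
    have e : ∀ z : ℝ × ℝ,
        (r n / n * (1 / h n ^ 2 * (k ((x - z.2) / h n) * obsWeight α β z))) ^ 2
          = (r n / n) ^ 2 * ((1 / h n ^ 2) ^ 2 * (k ((x - z.2) / h n) * obsWeight α β z) ^ 2) :=
      fun z => by ring
    simp_rw [e]
    rw [integral_const_mul, integral_const_mul,
      integral_kernel_mul_obsWeight_sq hF hq hq0 hk hk0 α β x hn]
    simp only [Function.comp_apply]
    field_simp

end KernelAverages

/-! ### Reduction of the estimator to kernel averages at one point. -/

section Reduction

theorem kernelAvg_linear (k : ℝ → ℝ) (j : ℕ) (α β α' β' a b : ℝ) (n : ℕ) (h : ℝ)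
    (Z : ℕ → ℝ × ℝ) (x : ℝ) :
    a * kernelAvg k j α β n h Z x + b * kernelAvg k j α' β' n h Z x
      = kernelAvg k j (a * α + b * α') (a * β + b * β') n h Z x := by
  have e : ∀ z : ℝ × ℝ, obsWeight (a * α + b * α') (a * β + b * β') z
      = a * obsWeight α β z + b * obsWeight α' β' z := by
    intro z
    unfold obsWeight
    split_ifs <;> ring
  simp only [kernelAvg, e, mul_add, Finset.sum_add_distrib, Finset.mul_sum]
  congr 1 <;> exact Finset.sum_congr rfl fun i _ => by ring

theorem kernelEst_eq_kernelAvg (w : ℝ → ℝ) (n : ℕ) (h : ℝ) (X T : ℕ → ℝ) (x : ℝ) :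
    kernelEst w n h T x = kernelAvg w 1 0 1 n h (fun i => (X i, T i)) x := by
  simp [kernelEst, kernelAvg, obsWeight]

theorem kernelDerivEst_eq_kernelAvg (w : ℝ → ℝ) (n : ℕ) (h : ℝ) (X T : ℕ → ℝ) (x : ℝ) :
    kernelDerivEst w n h T x = kernelAvg (deriv w) 2 0 1 n h (fun i => (X i, T i)) x := by
  simp [kernelDerivEst, kernelAvg, obsWeight]

variable {k : ℝ → ℝ} {h x X T : ℝ}

/-- If X > T, the observation lies at T + 1 ≥ 1 > x + h, outside the window of the kernel. -/
theorem kernel_transformedObs (hk0 : ∀ u, u ∉ Set.Icc (-1 : ℝ) 1 → k u = 0) (hh : 0 < h)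
    (hx : x + h < 1) (hT : T ∈ Set.Icc (0 : ℝ) 1) :
    k ((x - transformedObs X T) / h) = k ((x - T) / h) * obsWeight 1 0 (X, T) := by
  unfold transformedObs obsWeight
  split_ifs with hXT
  · simp
  · rw [hk0]
    · simp
    · rintro ⟨h1, -⟩
      rw [le_div_iff₀ hh] at h1
      linarith [hT.1]

/-- If X ≤ T, the observation lies at T ≤ 1 < x + 1 - h, outside the window of the kernel. -/
theorem kernel_add_one_transformedObs (hk0 : ∀ u, u ∉ Set.Icc (-1 : ℝ) 1 → k u = 0) (hh : 0 < h)
    (hx : h < x) (hT : T ∈ Set.Icc (0 : ℝ) 1) :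
    k ((x + 1 - transformedObs X T) / h) = k ((x - T) / h) * obsWeight (-1) 1 (X, T) := by
  unfold transformedObs obsWeight
  split_ifs with hXT
  · rw [hk0]
    · simp
    · rintro ⟨-, h1⟩
      rw [div_le_iff₀ hh] at h1
      linarith [hT.2]
  · simp

variable {w : ℝ → ℝ}

/-- The final estimator in terms of kernel averages at the single point `x`. -/
theorem finalEst_eq (hw : ConditionW w) (hh : 0 < h) (hx0 : h < x) (hx1 : x + h < 1) {n : ℕ}
    {X T : ℕ → ℝ} (hT : ∀ i, T i ∈ Set.Icc (0 : ℝ) 1) (h' φ a : ℝ) :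
    finalEst w n h h' X T φ x =
      1 / kernelAvg w 1 0 1 n h' (fun i => (X i, T i)) x
          * kernelAvg (deriv w) 2 1 (-a) n h (fun i => (X i, T i)) x
        - kernelAvg (deriv w) 2 0 1 n h' (fun i => (X i, T i)) x
            / kernelAvg w 1 0 1 n h' (fun i => (X i, T i)) x ^ 2
          * kernelAvg w 1 1 (-a) n h (fun i => (X i, T i)) x
        + (φ - a) * (kernelAvg (deriv w) 2 0 1 n h' (fun i => (X i, T i)) x
            / kernelAvg w 1 0 1 n h' (fun i => (X i, T i)) x ^ 2
          * kernelAvg w 1 0 1 n h (fun i => (X i, T i)) x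
          - 1 / kernelAvg w 1 0 1 n h' (fun i => (X i, T i)) x
          * kernelAvg (deriv w) 2 0 1 n h (fun i => (X i, T i)) x) := by
  have d1 : kernelDerivEst w n h (fun i => transformedObs (X i) (T i)) x
      = kernelAvg (deriv w) 2 1 0 n h (fun i => (X i, T i)) x := by
    simp only [kernelDerivEst, kernelAvg, kernel_transformedObs hw.deriv_eq_zero hh hx1 (hT _)]
  have d2 : kernelDerivEst w n h (fun i => transformedObs (X i) (T i)) (x + 1)
      = kernelAvg (deriv w) 2 (-1) 1 n h (fun i => (X i, T i)) x := by
    simp only [kernelDerivEst, kernelAvg,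
      kernel_add_one_transformedObs hw.deriv_eq_zero hh hx0 (hT _)]
  have e1 : kernelEst w n h (fun i => transformedObs (X i) (T i)) x
      = kernelAvg w 1 1 0 n h (fun i => (X i, T i)) x := by
    simp only [kernelEst, kernelAvg, kernel_transformedObs hw.eq_zero hh hx1 (hT _), pow_one]
  have e2 : kernelEst w n h (fun i => transformedObs (X i) (T i)) (x + 1)
      = kernelAvg w 1 (-1) 1 n h (fun i => (X i, T i)) x := by
    simp only [kernelEst, kernelAvg, kernel_add_one_transformedObs hw.eq_zero hh hx0 (hT _),
      pow_one]
  -- With Δ the indicator of X ≤ T, this is (1 - a) Δ - a (1 - Δ) = Δ - a; the later choice a = F(x)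
  -- centres the weight.
  have hA : ∀ (k : ℝ → ℝ) (j : ℕ), kernelAvg k j 1 (-a) n h (fun i => (X i, T i)) x
      = (1 - a) * kernelAvg k j 1 0 n h (fun i => (X i, T i)) x
        + (-a) * kernelAvg k j (-1) 1 n h (fun i => (X i, T i)) x := by
    intro k j
    rw [kernelAvg_linear]
    congr 1 <;> ring
  have hS : ∀ (k : ℝ → ℝ) (j : ℕ), kernelAvg k j 0 1 n h (fun i => (X i, T i)) x
      = 1 * kernelAvg k j 1 0 n h (fun i => (X i, T i)) x
        + 1 * kernelAvg k j (-1) 1 n h (fun i => (X i, T i)) x := by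
    intro k j
    rw [kernelAvg_linear]
    congr 1 <;> ring
  rw [finalEst, leftEst, rightEst, d1, d2, e1, e2, kernelEst_eq_kernelAvg w n h' X T,
    kernelDerivEst_eq_kernelAvg w n h' X T, hA w, hA (deriv w), hS w 1, hS (deriv w) 2]
  ring

end Reduction

/-! ### Smoothness and derivatives of the densities involved. -/

section Densities

variable {F f q : ℝ → ℝ} {x : ℝ}

/-- A distribution function is one degree smoother than its density. -/
theorem contDiffAt_of_eq_setIntegral {m : ℕ} (hfi : Integrable f)
    (hF : ∀ t, F t = ∫ s in Set.Iic t, f s) (hf : ContDiffAt ℝ m f x) :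
    ContDiffAt ℝ (m + 1) F x ∧ ∀ᶠ y in 𝓝 x, HasDerivAt F (f y) y := by
  have hd : ∀ᶠ y in 𝓝 x, HasDerivAt F (f y) y := by
    filter_upwards [hf.eventually (by simp)] with y hy
    have e : F = fun t => (∫ s in Set.Iic y, f s) + ∫ s in y..t, f s := by
      ext t
      rw [hF, ← intervalIntegral.integral_Iic_sub_Iic hfi.integrableOn hfi.integrableOn]
      ring
    rw [e]
    refine HasDerivAt.const_add _ (intervalIntegral.integral_hasDerivAt_right
      (hfi.intervalIntegrable) ?_ hy.continuousAt)
    exact hfi.aestronglyMeasurable.stronglyMeasurableAtFilter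
  refine ⟨contDiffAt_succ_iff_hasFDerivAt.2 ⟨fun y => ContinuousLinearMap.toSpanSingleton ℝ (f y),
    ⟨_, hd, fun y hy => (show HasDerivAt F (f y) y from hy).hasFDerivAt⟩, ?_⟩, hd⟩
  exact (ContinuousLinearMap.toSpanSingletonCLE (𝕜 := ℝ) (E := ℝ)).contDiff.contDiffAt.comp x hf

theorem contDiffAt_weightedDensity {m : WithTop ℕ∞} (hF : ContDiffAt ℝ m F x)
    (hq : ContDiffAt ℝ m q x) (α β : ℝ) : ContDiffAt ℝ m (weightedDensity F q α β) x := by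
  unfold weightedDensity
  exact ((contDiffAt_const.mul hF).add contDiffAt_const).mul hq

theorem weightedDensity_zero_one : weightedDensity F q 0 1 = q := by
  ext t
  simp [weightedDensity]

/-- The factor F - F(x) vanishes at x, so the product rule leaves only the term with its derivative,
and q' does not appear. -/
theorem deriv_weightedDensity_centered (hF : HasDerivAt F (f x) x) (hq : DifferentiableAt ℝ q x) :
    deriv (weightedDensity F q 1 (-F x)) x = q x * f x := by
  have h := (((hF.const_mul 1).add_const (-F x)).mul hq.hasDerivAt).deriv
  have e : weightedDensity F q 1 (-F x) = (fun t => 1 * F t + -F x) * q := rfl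
  rw [e, h]
  ring

/-- Derivatives of the density of the transformed observations at `x` and `x + 1`. -/
theorem iteratedDeriv_weightedDensity_eq {m : ℕ} (hx : x ∈ Set.Ioo (0 : ℝ) 1)
    (hF : ContDiffAt ℝ m F x) (hq : ContDiffAt ℝ m q x) (hF0 : ∀ t < 0, F t = 0)
    (hF1 : ∀ t > 1, F t = 1) (hq_zero : ∀ t, t ∉ Set.Icc (0 : ℝ) 1 → q t = 0) (a : ℝ) :
    iteratedDeriv m (weightedDensity F q 1 (-a)) x
      = (1 - a) * iteratedDeriv m (obsDensity F q) x
        - a * iteratedDeriv m (obsDensity F q) (x + 1) := by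
  -- For v in (0, 1) the points v - 1 and v + 1 lie outside [0, 1], so g(v) = F(v) q(v) and g(v + 1)
  -- = (1 - F(v)) q(v).
  have h1 : obsDensity F q =ᶠ[𝓝 x] weightedDensity F q 1 0 := by
    filter_upwards [isOpen_Ioo.mem_nhds hx] with v hv
    have : q (v - 1) = 0 := hq_zero _ fun h => by linarith [h.1, hv.2]
    rw [obsDensity, this, hF0 (v - 1) (by linarith [hv.2]), weightedDensity]
    ring
  have h2 : (fun v => obsDensity F q (v + 1)) =ᶠ[𝓝 x] weightedDensity F q (-1) 1 := by
    filter_upwards [isOpen_Ioo.mem_nhds hx] with v hv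
    have : q (v + 1) = 0 := hq_zero _ fun h => by linarith [h.2, hv.1]
    rw [obsDensity, this, hF1 (v + 1) (by linarith [hv.1]), weightedDensity, add_sub_cancel_right]
    ring
  have h3 := congrFun (iteratedDeriv_comp_add_const m (obsDensity F q) 1) x
  rw [h1.iteratedDeriv_eq, ← h3, h2.iteratedDeriv_eq]
  have e : weightedDensity F q 1 (-a)
      = fun t => (1 - a) * weightedDensity F q 1 0 t - a * weightedDensity F q (-1) 1 t := by
    ext t
    simp only [weightedDensity]
    ring
  have c1 := contDiffAt_weightedDensity hF hq 1 0
  have c2 := contDiffAt_weightedDensity hF hq (-1) 1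
  rw [e, iteratedDeriv_fun_sub (contDiffAt_const.mul c1) (contDiffAt_const.mul c2),
    iteratedDeriv_const_mul_field, iteratedDeriv_const_mul_field]

end Densities

/-! ### Linearization and the general limit theorem. -/

section MainLimit

theorem measurable_transformedObs {Ω : Type*} [MeasurableSpace Ω] {X T : Ω → ℝ}
    (hX : Measurable X) (hT : Measurable T) : Measurable fun ω => transformedObs (X ω) (T ω) :=
  Measurable.ite (measurableSet_le hX hT) hT (hT.add_const 1)

theorem measurable_kernelEst {Ω : Type*} [MeasurableSpace Ω] {w : ℝ → ℝ} (hw : ConditionW w)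
    {Y : ℕ → Ω → ℝ} (hY : ∀ i, Measurable (Y i)) (n : ℕ) (h y : ℝ) :
    Measurable fun ω => kernelEst w n h (fun i => Y i ω) y := by
  have hwm : Measurable w := hw.contDiff.continuous.measurable
  unfold kernelEst
  fun_prop

theorem measurable_kernelDerivEst {Ω : Type*} [MeasurableSpace Ω] {w : ℝ → ℝ}
    (hw : ConditionW w) {Y : ℕ → Ω → ℝ} (hY : ∀ i, Measurable (Y i)) (n : ℕ) (h y : ℝ) :
    Measurable fun ω => kernelDerivEst w n h (fun i => Y i ω) y := by
  have hwm : Measurable (deriv w) := hw.continuous_deriv.measurable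
  unfold kernelDerivEst
  fun_prop

theorem measurable_finalEst {Ω : Type*} [MeasurableSpace Ω] {w : ℝ → ℝ} (hw : ConditionW w)
    {X T : ℕ → Ω → ℝ} (hX : ∀ i, Measurable (X i)) (hT : ∀ i, Measurable (T i)) {φ : Ω → ℝ}
    (hφ : Measurable φ) (n : ℕ) (h h' y : ℝ) :
    Measurable fun ω => finalEst w n h h' (fun i => X i ω) (fun i => T i ω) (φ ω) y := by
  have hV : ∀ i, Measurable fun ω => transformedObs (X i ω) (T i ω) := fun i =>
    measurable_transformedObs (hX i) (hT i)
  have h1 := measurable_kernelEst hw hV n h y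
  have h2 := measurable_kernelEst hw hV n h (y + 1)
  have h3 := measurable_kernelDerivEst hw hV n h y
  have h4 := measurable_kernelDerivEst hw hV n h (y + 1)
  have h5 := measurable_kernelEst hw hT n h' y
  have h6 := measurable_kernelDerivEst hw hT n h' y
  unfold finalEst leftEst rightEst
  fun_prop

/-- The linearization error of the ratio that defines the final estimator. -/
theorem linearization_identity {r f₀ q₀ q₁ Q Q' A B S R D c : ℝ} (hQ : Q ≠ 0) :
    r * (1 / Q * A - Q' / Q ^ 2 * B + D * (Q' / Q ^ 2 * R - 1 / Q * S) - f₀)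
        - (r / q₀ * (A - q₀ * f₀) + c)
      = r * (A - q₀ * f₀) * (1 / Q - 1 / q₀) - f₀ * (r * (Q - q₀)) / Q
        - Q' / Q ^ 2 * (r * (B - 0))
        + (r * (Q' - q₁) * D * R + q₁ * (r * (R - q₀) * D - r * (Q - q₀) * D)
          - r * (S - q₁) * D * Q) / Q ^ 2 - c := by
  field_simp
  ring

/-- Asymptotic normality of the final estimator, for a general normalization `r`. -/
theorem tendstoInDistribution_finalEst {Ω : Type*} [MeasurableSpace Ω] {P : Measure Ω}
    [IsProbabilityMeasure P] {X T : ℕ → Ω → ℝ} {μX : Measure ℝ} [IsProbabilityMeasure μX]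
    {F q : ℝ → ℝ} [IsProbabilityMeasure (volume.withDensity fun t => ENNReal.ofReal (q t))]
    (hX : ∀ i, Measurable (X i)) (hT : ∀ i, Measurable (T i))
    (hZ : IsIIDSample (fun i ω => (X i ω, T i ω))
      (μX.prod (volume.withDensity fun t => ENNReal.ofReal (q t))) P)
    (hF : ∀ t, F t = μX.real (Set.Iic t)) (hq : Measurable q) (hq0 : ∀ t, 0 ≤ q t)
    (hT01 : ∀ᵐ ω ∂P, ∀ i, T i ω ∈ Set.Icc (0 : ℝ) 1) {w : ℝ → ℝ} (hw : ConditionW w) {x f₀ : ℝ}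
    (hx : x ∈ Set.Ioo (0 : ℝ) 1) (hF3 : ContDiffAt ℝ 3 F x) (hFd : HasDerivAt F f₀ x)
    (hq3 : ContDiffAt ℝ 3 q x) (hqx : 0 < q x) {Fhat : ℕ → Ω → ℝ}
    (hFhat : ∀ n, Measurable (Fhat n))
    (hD : Tendsto (fun z : ℕ × Ω => Fhat z.1 z.2 - F x) (probFilter P) (𝓝 0))
    {r h h' : ℕ → ℝ} {B B' γ γ' : ℝ} (hh : Tendsto h atTop (𝓝[>] 0))
    (hh' : Tendsto h' atTop (𝓝[>] 0)) (hr : Tendsto r atTop atTop)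
    (hγ : Tendsto (fun n : ℕ => r n ^ 2 / n * ((1 / h n ^ 2) ^ 2 * h n)) atTop (𝓝 γ))
    (hγ' : Tendsto (fun n : ℕ => r n ^ 2 / n * ((1 / h' n ^ 2) ^ 2 * h' n)) atTop (𝓝 γ'))
    (hB : Tendsto (fun n => r n * h n ^ 2) atTop (𝓝 B))
    (hB' : Tendsto (fun n => r n * h' n ^ 2) atTop (𝓝 B')) :
    TendstoInDistribution
      (fun n ω => r n * (finalEst w n (h n) (h' n) (fun i => X i ω) (fun i => T i ω)
        (Fhat n ω) x - f₀)) atTop (id : ℝ → ℝ) (fun _ => P)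
      (gaussianReal
        (1 / 2 * (∫ v, v ^ 2 * w v) *
          (B * (1 / q x * iteratedDeriv 3 (weightedDensity F q 1 (-F x)) x
            - deriv q x / q x ^ 2 * iteratedDeriv 2 (weightedDensity F q 1 (-F x)) x)
            - B' * (f₀ * iteratedDeriv 2 q x / q x)))
        (γ * limitVar w q F x).toNNReal) := by
  have hFx : ContinuousAt F x := hF3.continuousAt
  have hqxc : ContinuousAt q x := hq3.continuousAt
  have hwc := hw.contDiff.continuous
  have hwc' := hw.continuous_deriv
  have hle : 𝓝[>] (0 : ℝ) ≤ 𝓝[≠] 0 := nhdsWithin_mono _ fun a ha => ne_of_gt ha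
  have hnh : ∀ {a : ℕ → ℝ}, Tendsto a atTop (𝓝[>] 0) → Tendsto a atTop (𝓝 0) := fun ha =>
    ha.mono_right nhdsWithin_le_nhds
  have hpos : ∀ {a : ℕ → ℝ}, Tendsto a atTop (𝓝[>] 0) → ∀ᶠ n in atTop, 0 < a n := fun ha =>
    ha.eventually self_mem_nhdsWithin
  set p := weightedDensity F q 1 (-F x) with hp
  have hp3 : ContDiffAt ℝ 3 p x := contDiffAt_weightedDensity hF3 hq3 _ _
  have hpx : p x = 0 := by simp [hp, weightedDensity]
  have hpd : deriv p x = q x * f₀ :=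
    deriv_weightedDensity_centered (f := fun _ => f₀) hFd (hq3.differentiableAt (by norm_num))
  have biasE : ∀ α β, ContDiffAt ℝ 3 (weightedDensity F q α β) x →
      Tendsto (fun h : ℝ => (1 / h ^ 1 * (h * ∫ u, w u * weightedDensity F q α β (x - h * u))
        - weightedDensity F q α β x) / h ^ 2) (𝓝[>] 0)
        (𝓝 (iteratedDeriv 2 (weightedDensity F q α β) x / 2 * ∫ v, v ^ 2 * w v)) := by
    intro α β hc
    refine ((tendsto_integral_kernel_sub_div hw (measurable_weightedDensity hF hq α β)
      (hc.of_le (by norm_num))).mono_left hle).congr' ?_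
    filter_upwards [self_mem_nhdsWithin] with h hh
    have : h ≠ 0 := ne_of_gt hh
    field_simp
  have biasD : ∀ α β, ContDiffAt ℝ 3 (weightedDensity F q α β) x →
      Tendsto (fun h : ℝ => (1 / h ^ 2 * (h * ∫ u, deriv w u * weightedDensity F q α β (x - h * u))
        - deriv (weightedDensity F q α β) x) / h ^ 2) (𝓝[>] 0)
        (𝓝 (iteratedDeriv 3 (weightedDensity F q α β) x / 2 * ∫ v, v ^ 2 * w v)) := by
    intro α β hc
    refine ((tendsto_integral_deriv_kernel_sub_div hw hc).mono_left hle).congr' ?_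
    filter_upwards [self_mem_nhdsWithin] with h hh
    have : h ≠ 0 := ne_of_gt hh
    field_simp
  have bpE := biasE 1 (-F x) hp3
  have bpD := biasD 1 (-F x) hp3
  have hq3' : ContDiffAt ℝ 3 (weightedDensity F q 0 1) x := by rwa [weightedDensity_zero_one]
  have bqE := biasE 0 1 hq3'
  have bqD := biasD 0 1 hq3'
  rw [weightedDensity_zero_one] at bqE bqD
  rw [← hp, hpx] at bpE
  rw [← hp, hpd] at bpD
  -- Replacing a⁻² by a⁻¹ multiplies the variance by a², so the averages with kernel w have
  -- negligible variance on the scale r.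
  have hrate : ∀ {a : ℕ → ℝ} {g : ℝ}, Tendsto a atTop (𝓝[>] 0) →
      Tendsto (fun n : ℕ => r n ^ 2 / n * ((1 / a n ^ 2) ^ 2 * a n)) atTop (𝓝 g) →
      Tendsto (fun n : ℕ => r n ^ 2 / n * ((1 / a n ^ 1) ^ 2 * a n)) atTop (𝓝 0) := by
    intro a g ha hg
    have h1 := hg.mul ((hnh ha).pow 2)
    rw [zero_pow two_ne_zero, mul_zero] at h1
    refine h1.congr' ?_
    filter_upwards [hpos ha] with n hn
    field_simp
  have hrinv : Tendsto (fun n => (r n)⁻¹) atTop (𝓝 0) := tendsto_inv_atTop_zero.comp hr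
  -- Here 1 / (n h) is the variance factor r² / (n h³) times r⁻² h², hence tends to zero.
  have hnhn : Tendsto (fun n : ℕ => n * h n) atTop atTop := by
    have h1 := (hγ.mul (hrinv.pow 2)).mul ((hnh hh).pow 2)
    rw [zero_pow two_ne_zero, mul_zero] at h1
    have h2 : Tendsto (fun n : ℕ => (n * h n)⁻¹) atTop (𝓝[>] 0) := by
      refine tendsto_nhdsWithin_iff.2 ⟨h1.congr' ?_, ?_⟩
      · filter_upwards [hpos hh, hr.eventually_gt_atTop 0] with n hn hrn
        field_simp
      · filter_upwards [hpos hh, eventually_gt_atTop 0] with n hn hn0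
        have : (0 : ℝ) < n := by positivity
        exact inv_pos.2 (mul_pos this hn)
    exact (tendsto_inv_nhdsGT_zero.comp h2).congr fun n => inv_inv _
  have hr1 : Tendsto (fun z : ℕ × Ω => (r z.1)⁻¹) (probFilter P) (𝓝 0) :=
    hrinv.comp tendsto_fst_probFilter
  have hrpos : ∀ᶠ z : ℕ × Ω in probFilter P, 0 < r z.1 :=
    tendsto_fst_probFilter.eventually (hr.eventually_gt_atTop 0)
  -- the estimators of `q` and `q'` at bandwidth `h'`
  have tQ := tendsto_probFilter_kernelAvg hZ hF hq hq0 hFx hqxc hwc hw.eq_zero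
    (j := 1) (α := 0) (β := 1) (by rw [weightedDensity_zero_one]; exact bqE) hh'
    (hrate hh' hγ') hB'
  obtain ⟨CQ', hCQ'⟩ := exists_lintegral_sq_kernelAvg_le hZ hF hq hq0 hFx hqxc hwc'
    hw.deriv_eq_zero (j := 2) (α := 0) (β := 1) (by rw [weightedDensity_zero_one]; exact bqD) hh'
    hγ' hB'
  -- the kernel averages at bandwidth `h`
  have tB := tendsto_probFilter_kernelAvg hZ hF hq hq0 hFx hqxc hwc hw.eq_zero
    (j := 1) (α := 1) (β := -F x) bpE hh (hrate hh hγ) hB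
  obtain ⟨CA, hCA⟩ := exists_lintegral_sq_kernelAvg_le hZ hF hq hq0 hFx hqxc hwc'
    hw.deriv_eq_zero (j := 2) (α := 1) (β := -F x) bpD hh hγ hB
  obtain ⟨CS, hCS⟩ := exists_lintegral_sq_kernelAvg_le hZ hF hq hq0 hFx hqxc hwc'
    hw.deriv_eq_zero (j := 2) (α := 0) (β := 1) (by rw [weightedDensity_zero_one]; exact bqD) hh
    hγ hB
  have tR := tendsto_probFilter_kernelAvg hZ hF hq hq0 hFx hqxc hwc hw.eq_zero
    (j := 1) (α := 0) (β := 1) (by rw [weightedDensity_zero_one]; exact bqE) hh (hrate hh hγ) hB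
  have hmeas : ∀ {k : ℝ → ℝ}, Continuous k → ∀ (j : ℕ) (α β θ : ℝ) (a : ℕ → ℝ) (n : ℕ),
      Measurable fun ω => r n * (kernelAvg k j α β n (a n) (fun i => (X i ω, T i ω)) x - θ) :=
    fun hk j α β θ a n => ((measurable_kernelAvg hZ.measurable hk j α β n (a n) x).sub_const
      θ).const_mul _
  have cancel : ∀ {Y : ℕ × Ω → ℝ} {θ l : ℝ},
      Tendsto (fun z => r z.1 * (Y z - θ)) (probFilter P) (𝓝 l) →
      Tendsto Y (probFilter P) (𝓝 θ) := by
    intro Y θ l hY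
    have h1 := (hY.mul hr1).add_const θ
    rw [mul_zero, zero_add] at h1
    refine h1.congr' ?_
    filter_upwards [hrpos] with z hz
    field_simp
    ring
  have lQ := cancel tQ
  have lR := cancel tR
  have lQ' : Tendsto (fun z : ℕ × Ω => kernelAvg (deriv w) 2 0 1 z.1 (h' z.1)
      (fun i => (X i z.2, T i z.2)) x) (probFilter P) (𝓝 (deriv q x)) := by
    have h1 := (tendsto_mul_probFilter_of_lintegral_sq_le (W := fun n _ => (r n)⁻¹)
      (hmeas hwc' 2 0 1 (deriv q x) h') hCQ' hr1).add_const (deriv q x)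
    rw [zero_add] at h1
    refine h1.congr' ?_
    filter_upwards [hrpos] with z hz
    field_simp
    ring
  have hQinv : Tendsto (fun z : ℕ × Ω => 1 / kernelAvg w 1 0 1 z.1 (h' z.1)
      (fun i => (X i z.2, T i z.2)) x - 1 / q x) (probFilter P) (𝓝 0) := by
    simpa using (lQ.inv₀ hqx.ne').sub_const (q x)⁻¹
  have mA := tendsto_mul_probFilter_of_lintegral_sq_le (hmeas hwc' 2 1 (-F x) (q x * f₀) h) hCA
    (W := fun n ω => 1 / kernelAvg w 1 0 1 n (h' n) (fun i => (X i ω, T i ω)) x - 1 / q x) hQinv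
  have mQ' := tendsto_mul_probFilter_of_lintegral_sq_le (hmeas hwc' 2 0 1 (deriv q x) h') hCQ'
    (W := fun n ω => Fhat n ω - F x) hD
  have mS := tendsto_mul_probFilter_of_lintegral_sq_le (hmeas hwc' 2 0 1 (deriv q x) h) hCS
    (W := fun n ω => Fhat n ω - F x) hD
  have mR := tR.mul hD
  have mQ := tQ.mul hD
  set m₂ := ∫ v, v ^ 2 * w v with hm₂
  -- The limits of -f r (Q - q) / Q and -(Q' / Q²) r B are deterministic and enter the limit law as
  -- a shift.
  set c : ℝ := -(f₀ * (B' * (iteratedDeriv 2 q x / 2 * m₂)) / q x)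
    - deriv q x / q x ^ 2 * (B * (iteratedDeriv 2 p x / 2 * m₂)) with hc
  have clt := tendstoInDistribution_kernelAvg hZ hF hq hq0 hFx hqxc hwc' hw.deriv_eq_zero
    (α := 1) (β := -F x) bpD hh (r := fun n => r n / q x) (γ := γ / q x ^ 2) (B := B / q x)
    ((hγ.div_const (q x ^ 2)).congr fun n => by field_simp)
    ((hB.div_const (q x)).congr fun n => by ring) hnhn c
  have hmean : 1 / 2 * m₂ * (B * (1 / q x * iteratedDeriv 3 p x
      - deriv q x / q x ^ 2 * iteratedDeriv 2 p x) - B' * (f₀ * iteratedDeriv 2 q x / q x))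
      = B / q x * (iteratedDeriv 3 p x / 2 * m₂) + c := by
    rw [hc]
    ring
  -- The squared weight Δ - F(x) has conditional mean (1 - 2F(x)) F(x) + F(x)² = F(x) (1 - F(x)) at
  -- T = x.
  have hvar : γ * limitVar w q F x = γ / q x ^ 2 *
      (weightedDensity F q (1 ^ 2 + 2 * 1 * (-F x)) ((-F x) ^ 2) x * ∫ u, deriv w u ^ 2) := by
    rw [limitVar, weightedDensity]
    field_simp
    ring
  rw [hmean, hvar]
  refine tendstoInDistribution_of_tendstoInMeasure_sub _ _ clt ?_ fun n =>
    (((measurable_finalEst hw hX hT (hFhat n) n (h n) (h' n) x).sub_const _).const_mul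
      _).aemeasurable
  refine tendstoInMeasure_of_tendsto_probFilter ?_
  -- The limit is assembled term by term in the shape of the right side of `linearization_identity`.
  have hlim := ((((mA.sub ((tQ.const_mul f₀).div lQ hqx.ne')).sub
    ((lQ'.div (lQ.pow 2) (by positivity)).mul tB)).add
    ((((mQ'.mul lR).add ((mR.sub mQ).const_mul (deriv q x))).sub (mS.mul lQ)).div
      (lQ.pow 2) (by positivity))).sub_const c)
  have hzero : (0 - f₀ * (B' * (iteratedDeriv 2 q x / 2 * m₂)) / q x
      - deriv q x / q x ^ 2 * (B * (iteratedDeriv 2 p x / 2 * m₂))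
      + (0 * q x + deriv q x * (B * (iteratedDeriv 2 q x / 2 * m₂) * 0
        - B' * (iteratedDeriv 2 q x / 2 * m₂) * 0) - 0 * q x) / q x ^ 2 - c) = 0 := by
    rw [hc]
    ring
  rw [hzero] at hlim
  refine hlim.congr' ?_
  have hsmall : ∀ᶠ n in atTop, 0 < h n ∧ h n < x ∧ x + h n < 1 := by
    filter_upwards [hpos hh, (hnh hh).eventually_lt_const hx.1,
      (hnh hh).eventually_lt_const (sub_pos.2 hx.2)] with n h1 h2 h3
    exact ⟨h1, h2, by linarith⟩
  filter_upwards [tendsto_fst_probFilter.eventually hsmall, lQ.eventually_ne hqx.ne',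
    eventually_probFilter_of_ae (p := fun z => ∀ i, T i z.2 ∈ Set.Icc (0 : ℝ) 1)
      (.of_forall fun _ => hT01)] with z hz hQ hTz
  rw [Pi.sub_apply, Pi.sub_apply, finalEst_eq hw hz.1 hz.2.1 hz.2.2 hTz (h' z.1)
    (Fhat z.1 z.2) (F x), linearization_identity (q₁ := deriv q x) hQ]
  simp only [Pi.div_apply]

end MainLimit

/-! ### Bandwidths of order n^(-1/7). -/

section Bandwidths

/-- Powers of `n` with exponents in sevenths, in terms of `y = n ^ (1 / 7)`. -/
theorem rpow_sevenths {n : ℕ} (hn : 0 < n) :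
    0 < (n : ℝ) ^ (1 / 7 : ℝ) ∧ ((n : ℝ) ^ (1 / 7 : ℝ)) ^ 7 = n ∧
      (n : ℝ) ^ (2 / 7 : ℝ) = ((n : ℝ) ^ (1 / 7 : ℝ)) ^ 2 ∧
      (n : ℝ) ^ (-(1 / 7) : ℝ) = ((n : ℝ) ^ (1 / 7 : ℝ))⁻¹ := by
  have hn0 : (0 : ℝ) < n := by positivity
  refine ⟨by positivity, ?_, ?_, Real.rpow_neg hn0.le _⟩
  · rw [← Real.rpow_natCast, ← Real.rpow_mul hn0.le]
    norm_num
  · rw [← Real.rpow_natCast, ← Real.rpow_mul hn0.le]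
    norm_num

theorem tendsto_const_mul_rpow_neg_seventh {c : ℝ} (hc : 0 < c) :
    Tendsto (fun n : ℕ => c * (n : ℝ) ^ (-(1 / 7) : ℝ)) atTop (𝓝[>] 0) := by
  refine tendsto_nhdsWithin_iff.2 ⟨?_, ?_⟩
  · simpa using ((tendsto_rpow_neg_atTop (y := 1 / 7) (by norm_num)).comp
      tendsto_natCast_atTop_atTop).const_mul c
  · filter_upwards [eventually_gt_atTop 0] with n hn
    have hn0 : (0 : ℝ) < n := by positivity
    exact mul_pos hc (Real.rpow_pos_of_pos hn0 _)

end Bandwidths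

/-! ### Passing from laws to densities and distribution functions. -/

section Sample

variable {Ω : Type*} [MeasurableSpace Ω] {P : Measure Ω}

theorem ae_mem_of_map_eq_withDensity {T : Ω → ℝ} (hT : Measurable T) {q : ℝ → ℝ} {s : Set ℝ}
    (hs : MeasurableSet s) (hTq : P.map T = volume.withDensity fun t => ENNReal.ofReal (q t))
    (hq : ∀ t, t ∉ s → q t = 0) : ∀ᵐ ω ∂P, T ω ∈ s := by
  refine ae_of_ae_map hT.aemeasurable ?_
  rw [hTq, ae_iff]
  have h0 : volume.withDensity (fun t => ENNReal.ofReal (q t)) sᶜ = 0 := by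
    rw [withDensity_apply _ hs.compl, setLIntegral_congr_fun hs.compl
      (g := fun _ => 0) fun t ht => by simp [hq t ht]]
    simp
  exact h0

/-- A density of a probability distribution is integrable, and its primitive is the distribution
function. -/
theorem integrable_and_eq_setIntegral_of_withDensity {μ : Measure ℝ} [IsProbabilityMeasure μ]
    {f : ℝ → ℝ} (hf : Measurable f) (hf0 : ∀ t, 0 ≤ f t)
    (hμ : μ = volume.withDensity fun t => ENNReal.ofReal (f t)) :
    Integrable f ∧ ∀ t, μ.real (Set.Iic t) = ∫ s in Set.Iic t, f s := by
  constructor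
  · refine ⟨hf.aestronglyMeasurable, ?_⟩
    rw [hasFiniteIntegral_iff_ofReal (.of_forall hf0)]
    have h1 : μ Set.univ = 1 := measure_univ
    rw [hμ, withDensity_apply _ MeasurableSet.univ, Measure.restrict_univ] at h1
    rw [h1]
    exact ENNReal.one_lt_top
  · intro t
    rw [integral_eq_lintegral_of_nonneg_ae (.of_forall hf0) hf.aestronglyMeasurable,
      measureReal_def, hμ, withDensity_apply _ measurableSet_Iic]

end Sample

/-! ### The two bandwidth regimes. -/

theorem mainTheorem2 {Ω : Type*} [MeasurableSpace Ω] (P : Measure Ω) [IsProbabilityMeasure P]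
    (X T : ℕ → Ω → ℝ) (hX : ∀ i, Measurable (X i)) (hT : ∀ i, Measurable (T i))
    -- the pairs `(X i, T i)` are independent, and `X i` is independent of `T i`
    (hindep : iIndepFun (fun i ω => (X i ω, T i ω)) P)
    (hXT : ∀ i, IndepFun (X i) (T i) P)
    -- the `X i` take values in `[0, 1]` and have density `f` and distribution function `F`
    (f F : ℝ → ℝ) (hf : Measurable f) (hf_nonneg : ∀ t, 0 ≤ f t)
    (hXf : ∀ i, P.map (X i) = volume.withDensity (fun t => ENNReal.ofReal (f t)))
    (hX01 : ∀ i, ∀ᵐ ω ∂P, X i ω ∈ Set.Icc (0 : ℝ) 1)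
    (hF : ∀ t, F t = P.real {ω | X 0 ω ≤ t})
    -- the `T i` have density `q`, which is positive on `[0, 1]` and zero elsewhere
    (q : ℝ → ℝ) (hq : Measurable q)
    (hTq : ∀ i, P.map (T i) = volume.withDensity (fun t => ENNReal.ofReal (q t)))
    (hq_pos : ∀ t ∈ Set.Icc (0 : ℝ) 1, 0 < q t)
    (hq_zero : ∀ t, t ∉ Set.Icc (0 : ℝ) 1 → q t = 0)
    (w : ℝ → ℝ) (hw : ConditionW w)
    (x : ℝ) (hx : x ∈ Set.Ioo (0 : ℝ) 1)
    (hf_smooth : ContDiffAt ℝ 2 f x) (hq_smooth : ContDiffAt ℝ 3 q x)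
    -- `Fhat n` is an estimator of `F x`, consistent in mean square
    (Fhat : ℕ → Ω → ℝ) (hFhat : ∀ n, Measurable (Fhat n))
    (hFhat_mse : Tendsto (fun n => ∫⁻ ω, ENNReal.ofReal ((Fhat n ω - F x) ^ 2) ∂P) atTop (𝓝 0)) :
    -- both bandwidths of order `n^(-1/7)`
    (∀ c c' : ℝ, 0 < c → 0 < c' →
      TendstoInDistribution
        (fun (n : ℕ) ω => (n : ℝ) ^ (2 / 7 : ℝ) *
          (finalEst w n (c * (n : ℝ) ^ (-(1 / 7) : ℝ)) (c' * (n : ℝ) ^ (-(1 / 7) : ℝ))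
            (fun i => X i ω) (fun i => T i ω) (Fhat n ω) x - f x))
        atTop (id : ℝ → ℝ) (fun _ => P)
        (gaussianReal (limitMean w f q F c c' x)
          (c ^ (-3 : ℤ) * limitVar w q F x).toNNReal)) ∧
    -- suboptimal bandwidth `h`
    (∀ (h : ℕ → ℝ) (c' : ℝ), 0 < c' →
      Tendsto (fun n : ℕ => (n : ℝ) * h n ^ 3) atTop atTop →
      h =o[atTop] (fun n : ℕ => (n : ℝ) ^ (-(1 / 7) : ℝ)) →
      TendstoInDistribution
        (fun (n : ℕ) ω => √((n : ℝ) * h n ^ 3) *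
          (finalEst w n (h n) (c' * (n : ℝ) ^ (-(1 / 7) : ℝ))
            (fun i => X i ω) (fun i => T i ω) (Fhat n ω) x - f x))
        atTop (id : ℝ → ℝ) (fun _ => P)
        (gaussianReal 0 (limitVar w q F x).toNNReal)) := by
  set μX := P.map (X 0) with hμX
  have : IsProbabilityMeasure μX := Measure.isProbabilityMeasure_map (hX 0).aemeasurable
  have : IsProbabilityMeasure (volume.withDensity fun t => ENNReal.ofReal (q t)) := by
    rw [← hTq 0]
    exact Measure.isProbabilityMeasure_map (hT 0).aemeasurable
  have hq0 : ∀ t, 0 ≤ q t := fun t => by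
    by_cases ht : t ∈ Set.Icc (0 : ℝ) 1
    · exact (hq_pos t ht).le
    · exact (hq_zero t ht).ge
  have hF' : ∀ t, F t = μX.real (Set.Iic t) := fun t => by
    rw [hF, hμX, map_measureReal_apply (hX 0) measurableSet_Iic]
    rfl
  have hZ : IsIIDSample (fun i ω => (X i ω, T i ω))
      (μX.prod (volume.withDensity fun t => ENNReal.ofReal (q t))) P :=
    ⟨fun i => (hX i).prodMk (hT i), hindep, fun i => by
      rw [(indepFun_iff_map_prod_eq_prod_map_map (hX i).aemeasurable (hT i).aemeasurable).1
        (hXT i), hXf i, hTq i, hμX, hXf 0]⟩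
  have hT01 : ∀ᵐ ω ∂P, ∀ i, T i ω ∈ Set.Icc (0 : ℝ) 1 := ae_all_iff.2 fun i =>
    ae_mem_of_map_eq_withDensity (hT i) measurableSet_Icc (hTq i) hq_zero
  obtain ⟨hfi, hFi⟩ := integrable_and_eq_setIntegral_of_withDensity hf hf_nonneg (hXf 0)
  obtain ⟨hF3, hFd⟩ := contDiffAt_of_eq_setIntegral (m := 2) hfi
    (fun t => (hF' t).trans (hFi t)) hf_smooth
  have hF3 : ContDiffAt ℝ 3 F x := by
    norm_num at hF3
    exact hF3
  have hFd : HasDerivAt F (f x) x := hFd.self_of_nhds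
  have hF0 : ∀ t < 0, F t = 0 := fun t ht => by
    rw [hF, measureReal_def, measure_eq_zero_iff_ae_notMem.2, ENNReal.toReal_zero]
    filter_upwards [hX01 0] with ω hω h
    exact absurd (hω.1.trans h) (not_le.2 ht)
  have hF1 : ∀ t > 1, F t = 1 := fun t ht => by
    have : ∀ᵐ ω ∂P, ω ∈ {ω | X 0 ω ≤ t} := by
      filter_upwards [hX01 0] with ω hω
      exact hω.2.trans ht.le
    rw [hF, measureReal_def, (prob_compl_eq_zero_iff (measurableSet_le (hX 0) measurable_const)).1 this,
      ENNReal.toReal_one]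
  have hqx : 0 < q x := hq_pos x ⟨hx.1.le, hx.2.le⟩
  have hD : Tendsto (fun z : ℕ × Ω => Fhat z.1 z.2 - F x) (probFilter P) (𝓝 0) :=
    tendsto_probFilter_of_lintegral_sq (Y := fun n ω => Fhat n ω - F x)
      (fun n => (hFhat n).sub_const _) hFhat_mse
  have h2 := iteratedDeriv_weightedDensity_eq (m := 2) hx (hF3.of_le (by norm_num))
    (hq_smooth.of_le (by norm_num)) hF0 hF1 hq_zero (F x)
  have h3 := iteratedDeriv_weightedDensity_eq (m := 3) hx hF3 hq_smooth hF0 hF1 hq_zero (F x)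
  have limit := fun {r h h' : ℕ → ℝ} {B B' γ γ' : ℝ} => tendstoInDistribution_finalEst hX hT hZ
    hF' hq hq0 hT01 hw hx hF3 hFd hq_smooth hqx hFhat hD (r := r) (h := h) (h' := h') (B := B)
    (B' := B') (γ := γ) (γ' := γ')
  constructor
  · intro c c' hc hc'
    have hr : Tendsto (fun n : ℕ => (n : ℝ) ^ (2 / 7 : ℝ)) atTop atTop :=
      (tendsto_rpow_atTop (by norm_num)).comp tendsto_natCast_atTop_atTop
    have hrate : ∀ a : ℝ, 0 < a → Tendsto (fun n : ℕ => ((n : ℝ) ^ (2 / 7 : ℝ)) ^ 2 / n *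
        ((1 / (a * (n : ℝ) ^ (-(1 / 7) : ℝ)) ^ 2) ^ 2 * (a * (n : ℝ) ^ (-(1 / 7) : ℝ)))) atTop
        (𝓝 (a ^ (-3 : ℤ))) := by
      intro a ha
      refine tendsto_const_nhds.congr' ?_
      filter_upwards [eventually_gt_atTop 0] with n hn
      obtain ⟨hy, h7, e2, e1⟩ := rpow_sevenths hn
      rw [e1, e2]
      nth_rewrite 2 [← h7]
      field_simp
    have hbias : ∀ a : ℝ, Tendsto (fun n : ℕ => (n : ℝ) ^ (2 / 7 : ℝ) *
        (a * (n : ℝ) ^ (-(1 / 7) : ℝ)) ^ 2) atTop (𝓝 (a ^ 2)) := by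
      intro a
      refine tendsto_const_nhds.congr' ?_
      filter_upwards [eventually_gt_atTop 0] with n hn
      obtain ⟨hy, -, e2, e1⟩ := rpow_sevenths hn
      rw [e1, e2]
      field_simp
    have key := limit (tendsto_const_mul_rpow_neg_seventh hc)
      (tendsto_const_mul_rpow_neg_seventh hc') hr (hrate c hc) (hrate c' hc') (hbias c) (hbias c')
    have hmean : limitMean w f q F c c' x = 1 / 2 * (∫ v, v ^ 2 * w v) *
          (c ^ 2 * (1 / q x * iteratedDeriv 3 (weightedDensity F q 1 (-F x)) x
            - deriv q x / q x ^ 2 * iteratedDeriv 2 (weightedDensity F q 1 (-F x)) x)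
            - c' ^ 2 * (f x * iteratedDeriv 2 q x / q x)) := by
      rw [h2, h3, limitMean, biasLeft, biasRight]
      ring
    rw [hmean]
    exact key
  · intro h c' hc' hnh ho
    -- Positivity of h is not assumed; it holds eventually since n h³ → ∞ and the cube preserves
    -- signs.
    have hpos : ∀ᶠ n in atTop, 0 < h n := by
      filter_upwards [hnh.eventually_gt_atTop 0, eventually_gt_atTop 0] with n hn hn0
      have hn1 : (0 : ℝ) < n := by positivity
      have h3 : 0 < h n ^ 3 := (mul_pos_iff_of_pos_left hn1).1 hn
      exact (Odd.pow_pos_iff (by decide)).1 h3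
    have hy : Tendsto (fun n : ℕ => h n * (n : ℝ) ^ (1 / 7 : ℝ)) atTop (𝓝 0) := by
      refine ho.tendsto_div_nhds_zero.congr' ?_
      filter_upwards [eventually_gt_atTop 0] with n hn
      rw [(rpow_sevenths hn).2.2.2, div_inv_eq_mul]
    have hh : Tendsto h atTop (𝓝[>] 0) := by
      refine tendsto_nhdsWithin_iff.2 ⟨ho.trans_tendsto ?_, hpos⟩
      exact (tendsto_rpow_neg_atTop (y := 1 / 7) (by norm_num)).comp tendsto_natCast_atTop_atTop
    have hr : Tendsto (fun n : ℕ => √((n : ℝ) * h n ^ 3)) atTop atTop :=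
      Real.tendsto_sqrt_atTop.comp hnh
    have hsq : ∀ {u v : ℕ → ℝ}, (∀ᶠ n in atTop, u n ^ 2 = v n) → Tendsto v atTop (𝓝 0) →
        Tendsto u atTop (𝓝 0) := by
      intro u v huv hv
      rw [tendsto_zero_iff_abs_tendsto_zero]
      have h1 := (Real.continuous_sqrt.tendsto _).comp hv
      rw [Real.sqrt_zero] at h1
      refine h1.congr' ?_
      filter_upwards [huv] with n hn
      rw [Function.comp_apply, Function.comp_apply, ← hn, Real.sqrt_sq_eq_abs]
    have key := limit (γ := 1) (γ' := 0) (B := 0) (B' := 0) hh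
      (tendsto_const_mul_rpow_neg_seventh hc') hr ?_ ?_ ?_ ?_
    · simpa using key
    -- Here r² = n h³, so the variance factor is exactly 1.
    · refine tendsto_const_nhds.congr' ?_
      filter_upwards [hpos, eventually_gt_atTop 0] with n hn hn0
      have hn1 : (0 : ℝ) < n := by positivity
      rw [Real.sq_sqrt (by positivity)]
      field_simp
    -- The variance factor at the other bandwidth h' is (h / h')³.
    · have h1 := (hy.pow 3).const_mul (1 / c' ^ 3)
      rw [zero_pow (by norm_num), mul_zero] at h1
      refine h1.congr' ?_
      filter_upwards [hpos, eventually_gt_atTop 0] with n hn hn0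
      have hn1 : (0 : ℝ) < n := by positivity
      obtain ⟨hy0, h7, -, e1⟩ := rpow_sevenths hn0
      rw [Real.sq_sqrt (by positivity), e1]
      field_simp
    -- The square of r h² is n h⁷ = (h n^(1/7))⁷.
    · have h1 := hy.pow 7
      rw [zero_pow (by norm_num)] at h1
      refine hsq ?_ h1
      filter_upwards [hpos, eventually_gt_atTop 0] with n hn hn0
      have hn1 : (0 : ℝ) < n := by positivity
      obtain ⟨hy0, h7, -, e1⟩ := rpow_sevenths hn0
      rw [mul_pow, Real.sq_sqrt (by positivity), mul_pow, h7]
      ring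
    -- The square of r h'² is n h³ h'⁴ = c'⁴ (h n^(1/7))³.
    · have h1 := (hy.pow 3).const_mul (c' ^ 4)
      rw [zero_pow (by norm_num), mul_zero] at h1
      refine hsq ?_ h1
      filter_upwards [hpos, eventually_gt_atTop 0] with n hn hn0
      have hn1 : (0 : ℝ) < n := by positivity
      obtain ⟨hy0, h7, -, e1⟩ := rpow_sevenths hn0
      rw [mul_pow, Real.sq_sqrt (by positivity), e1]
      nth_rewrite 1 [← h7]
      field_simp
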